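/- Let $t\ge 1$ and $N$ be integers. For $c=(c_{ijl})\in\mathbb C^{t\times(t+1)\times N}$ let $M=M_c$ be the $t\times(t+1)$ matrix of linear forms $M_{ij}=\sum_{l=1}^N c_{ijl}x_l$ and let $X\subset(\mathbb C^N,0)$ be the scheme defined by the maximal minors of $M$. Assume that $X$ is an isolated Cohen–Macaulay codimension $2$ singularity (ICMC2) of type $(t,t+1,t)$, i.e. $X$ has codimension $2$ and is smooth outside the origin (a smooth germ is allowed). Let $W$ be the closure in $\mathbb C^{t\times(t+1)}\times\mathbb P^{t-1}$ of the set of pairs $(B,[s])$ with $\operatorname{rk}B=t-1$ and $s^{T}B=0$ (the graph of the map sending a matrix of rank $t-1$ to its column span, a hyperplane of $\mathbb C^t$), and let the Tjurina transform $Y\subset\mathbb C^N\times\mathbb P^{t-1}$ of $X$ be the pullback of $W$ along $M:\mathbb C^N\to\mathbb C^{t\times(t+1)}$. Let $A(s)$ be the $(t+1)\times N$ matrix of linear forms in $s=(s_1,\dots,s_t)$ with entries $A_{jl}=\sum_{i=1}^t c_{ijl}s_i$. Then, for generic $c$ (that is, for all $c$ as above in a suitable nonempty Zariski open subset of the coefficient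 space): 1. If $N\ge 3$ or $t=1$, then $Y$ is smooth if and only if $N\ge 2t$. 2. If $t+1\le N<2t$, then the singular locus of $Y$ is, as a set, $\{0\}\times\Sigma$, where $\Sigma\subset\mathbb P^{t-1}$ is the zero set of the maximal minors of $A(s)$. It is a determinantal variety of type $(t+1,N,t+1)$, i.e. of the expected codimension $N-t$, and has dimension $2t-N-1$. Moreover $A(s)$ is a generic matrix of linear forms: every property that holds for generic $(t+1)\times N$ matrices of linear forms in $t$ variables holds for $A(s)$ if $c$ is generic. -/

import Mathlib

noncomputable section

namespace TjurinaTransform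

open scoped LinearAlgebra.Projectivization

/-- A property of points of the complex affine space `ℂ^ι` holds for the generic point if it holds
on a nonempty Zariski open subset, i.e. off the zero set of some nonzero polynomial. -/
def Generic {ι : Type*} (P : (ι → ℂ) → Prop) : Prop :=
  ∃ G : MvPolynomial ι ℂ, G ≠ 0 ∧ ∀ c : ι → ℂ, MvPolynomial.eval c G ≠ 0 → P c

/-- Coefficients of an `m × n` matrix of linear forms in `k` variables:
`c (i, j, l)` is the coefficient of the `l`-th variable in the `(i, j)`-entry. -/
abbrev LinCoeff (m n k : ℕ) : Type := Fin m × Fin n × Fin k → ℂ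

/-- The `m × n` matrix of linear forms in `k` variables with the given coefficients. -/
def linMatrix {m n k : ℕ} (c : LinCoeff m n k) :
    Matrix (Fin m) (Fin n) (MvPolynomial (Fin k) ℂ) :=
  Matrix.of fun i j => ∑ l : Fin k, MvPolynomial.C (c (i, j, l)) * MvPolynomial.X l

/-- The ideal generated by the `r`-minors of a matrix. (Non-injective choices of rows or columns
contribute `0`, and reorderings only change a sign.) -/
def minorsIdeal {R : Type*} [CommRing R] {m n : ℕ} (F : Matrix (Fin m) (Fin n) R) (r : ℕ) :
    Ideal R :=
  Ideal.span {d | ∃ (f : Fin r → Fin m) (g : Fin r → Fin n), d = (F.submatrix f g).det}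

/-- The polynomial matrix `F`, seen as a map from affine space to the `m × n` matrices, defines
a determinantal variety of type `(m, n, r)`: the preimage of the matrices of rank `< r`
has the expected codimension `(m - r + 1)(n - r + 1)`. For a matrix of linear forms the variety is
a cone, and its codimension is also that of the corresponding projective variety
when the latter is nonempty. -/
def IsDeterminantal {m n k : ℕ} (F : Matrix (Fin m) (Fin n) (MvPolynomial (Fin k) ℂ))
    (r : ℕ) : Prop :=
  1 ≤ r ∧ r ≤ m ∧ r ≤ n ∧
    (minorsIdeal F r).height = (((m - r + 1) * (n - r + 1) : ℕ) : ℕ∞)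

/-- The local ring of `V(I)` at the point `x` is smooth over `ℂ`
(the prime `q` is the maximal ideal of the point `x`). -/
def IsSmoothPoint {σ : Type*} (I : Ideal (MvPolynomial σ ℂ)) (x : σ → ℂ) : Prop :=
  ∃ q ∈ Algebra.smoothLocus ℂ (MvPolynomial σ ℂ ⧸ I),
    q.asIdeal.comap (Ideal.Quotient.mk I) = MvPolynomial.vanishingIdeal ℂ {x}

/-- The singular points of the affine scheme `V(I)`. -/
def singularPoints {σ : Type*} (I : Ideal (MvPolynomial σ ℂ)) : Set (σ → ℂ) :=
  {x | x ∈ MvPolynomial.zeroLocus ℂ I ∧ ¬ IsSmoothPoint I x}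

/-- The maximal minors of the `t × (t + 1)` matrix of linear forms with coefficients `c` define an
isolated Cohen-Macaulay codimension 2 singularity `X` in `(ℂ^N, 0)`: `X` is a determinantal
variety of type `(t, t + 1, t)`, that is, has codimension 2 (the local ring is then
Cohen-Macaulay by the Hilbert-Burch / Eagon-Hochster theorem), and it has no
singular point other than, possibly, the origin. Since `X` is a cone, the condition on `X` and the
condition on its germ at the origin are the same. -/
def IsICMC2 {t N : ℕ} (c : LinCoeff t (t + 1) N) : Prop :=
  IsDeterminantal (linMatrix c) t ∧
    ∀ x ∈ singularPoints (minorsIdeal (linMatrix c) t), x = 0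

/-- The graph of the rational map sending an `m × n` matrix of rank `m - 1` to its column
span, a hyperplane of `ℂ^m`, in the chart `s i = 1` of the projective space of hyperplanes:
the hyperplane `∑ a, s a * v a = 0` has homogeneous coordinates `s`. -/
def graphChart (m n : ℕ) (i : Fin m) : Set ((Fin m × Fin n) ⊕ Fin m → ℂ) :=
  {z | (Matrix.of fun a b => z (Sum.inl (a, b)) : Matrix (Fin m) (Fin n) ℂ).rank + 1 = m ∧
    z (Sum.inr i) = 1 ∧ ∀ b, ∑ a, z (Sum.inr a) * z (Sum.inl (a, b)) = 0}

/-- The ideal, in the chart `s i = 1` of `ℂ^k × ℙ^(m-1)`, of the Tjurina transform of the variety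
defined by the maximal minors of the `m × n` matrix `F` (`m ≤ n`): the transform is the
scheme-theoretic pullback, along `F`, of the closure `W` of the graph of the column span map, and
pulling back replaces the matrix coordinates by the entries of `F` in the equations of `W`. -/
def tjurinaIdeal {m n k : ℕ} (F : Matrix (Fin m) (Fin n) (MvPolynomial (Fin k) ℂ)) (i : Fin m) :
    Ideal (MvPolynomial (Fin k ⊕ Fin m) ℂ) :=
  (MvPolynomial.vanishingIdeal ℂ (graphChart m n i)).map
    (MvPolynomial.aeval (Sum.elim
      (fun p : Fin m × Fin n => MvPolynomial.rename Sum.inl (F p.1 p.2))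
      (fun a : Fin m => MvPolynomial.X (Sum.inr a))) :
        MvPolynomial ((Fin m × Fin n) ⊕ Fin m) ℂ →ₐ[ℂ] MvPolynomial (Fin k ⊕ Fin m) ℂ)

/-- The coordinates, in the chart `s i = 1`, of a point of `ℂ^k × ℙ^(m-1)`. -/
def chartPoint {m k : ℕ} (i : Fin m) (y : (Fin k → ℂ) × ℙ ℂ (Fin m → ℂ)) :
    Fin k ⊕ Fin m → ℂ :=
  Sum.elim y.1 ((y.2.rep i)⁻¹ • y.2.rep)

/-- The singular locus of the Tjurina transform, as a subset of `ℂ^k × ℙ^(m-1)`. -/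
def tjurinaSing {m n k : ℕ} (F : Matrix (Fin m) (Fin n) (MvPolynomial (Fin k) ℂ)) :
    Set ((Fin k → ℂ) × ℙ ℂ (Fin m → ℂ)) :=
  {y | ∃ i, y.2.rep i ≠ 0 ∧ chartPoint i y ∈ singularPoints (tjurinaIdeal F i)}

/-- The Tjurina transform is smooth: it has no singular point. -/
def TjurinaSmooth {m n k : ℕ} (F : Matrix (Fin m) (Fin n) (MvPolynomial (Fin k) ℂ)) : Prop :=
  tjurinaSing F = ∅

/-- The coefficients of the `(t + 1) × N` matrix `A` of linear forms in `s` whose `(j, l)`-entry is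
`∑ i, c (i, j, l) * s i`, that is, the derivative by `x l` of the bilinear form
`∑ i, s i * M i j` if `M` is the matrix of linear forms in `x` with coefficients `c`. -/
def derivCoeff {t N : ℕ} (c : LinCoeff t (t + 1) N) : LinCoeff (t + 1) N t :=
  fun p => c (p.2.2, p.1, p.2.1)

/-- The zero set in projective space of a homogeneous ideal. -/
def projZeros {t : ℕ} (I : Ideal (MvPolynomial (Fin t) ℂ)) : Set (ℙ ℂ (Fin t → ℂ)) :=
  {p | ∀ f ∈ I, MvPolynomial.eval p.rep f = 0}

/-- A subset `Z` of `ℙ^(t-1)` has dimension `d` in the Zariski topology: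
the affine cone over `Z` has dimension `d + 1`. -/
def HasProjDim {t : ℕ} (Z : Set (ℙ ℂ (Fin t → ℂ))) (d : ℕ) : Prop :=
  ringKrullDim (MvPolynomial (Fin t) ℂ ⧸
      MvPolynomial.vanishingIdeal ℂ {v : Fin t → ℂ | ∃ p ∈ Z, v ∈ p.submodule}) =
    ((d + 1 : ℕ) : WithBot ℕ∞)

end TjurinaTransform

end

/-! In the chart `s i = 1` the closure of the graph is an affine space, cut out by `s i - 1` and the
bilinear equations `sᵀB = 0` (`vanishingIdeal_graphChart`). Hence `Y` is given by `s i = 1` and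
`sᵀM(x) = A(s)x = 0`. The Jacobian row of the `j`-th bilinear equation consists of the `j`-th row of
`A(s)` and the `j`-th column of `M(x)`.

Off the origin these rows are independent. A relation `v` would satisfy `vᵀA(s) = 0` and `M(x)v =
0`, which makes the gradients at `x` of all maximal minors of `M` proportional. Since `X` is smooth
at `x`, its ideal would then have height at most one, not two
(`IsICMC2.eq_zero_of_vecMul_of_mulVec`). Over `x = 0` we have `M(0) = 0`, so the point is smooth
once the rows of `A(s)` are independent. Conversely, near a smooth point the ideal is generated by
equations whose gradients span all gradients there, and comparing gradients along the exceptional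
fibre shows that `A(s)` has there its largest rank (`rank_le_of_isSmoothPoint_tjurinaIdeal`). For
generic `c` this rank is `min (t + 1) N`, so for `N ≥ t + 1` the singular points are those of `{0} ×
Σ`.

It remains to study generic matrices of linear forms, since `c ↦ A` only permutes coefficients. If
`N ≥ 2t`, a Toeplitz matrix has independent rows at every nonzero point (`exists_fullRank`), and
elimination makes this generic (`generic_of_forall_eq_zero`). If `N < 2t`, a rank drop is a zero of
a bilinear system on a product of projective spaces of sufficient dimension
(`exists_vecMul_evalMatrix_eq_zero`); this needs `N ≥ 3` when `N ≤ t`. For `t = 1` the case `N < 2`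
is excluded by codimension two.

For the dimension of `Σ`, put `p = N - t`. Generically the affine cone meets the span of the first
`p` coordinates only at the origin and surjects onto the other `t - p` coordinates. Thus `p` forms
in the ideal and `t - p` coordinates are homogeneous parameters, and integrality yields height and
dimension (`height_eq_and_ringKrullDim_eq`). -/

noncomputable section

namespace TjurinaTransform

open MvPolynomial

open scoped LinearAlgebra.Projectivization

/-! ### Jacobian criterion at closed points -/

section Smooth

open TensorProduct KaehlerDifferential

variable {σ : Type*}

/-- The gradient of a polynomial at a point. -/
def grad (y : σ → ℂ) : MvPolynomial σ ℂ →ₗ[ℂ] (σ → ℂ) :=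
  LinearMap.pi fun i => (aeval y).toLinearMap ∘ₗ (pderiv i).toLinearMap

@[simp]
lemma grad_apply (y : σ → ℂ) (f : MvPolynomial σ ℂ) (i : σ) :
    grad y f i = eval y (pderiv i f) := by
  simp [grad, aeval_eq_eval]

/-- The evaluation at `y` on the local ring of the affine space at `y`. -/
def localEval (y : σ → ℂ) :
    Localization.AtPrime (vanishingIdeal ℂ {y} : Ideal (MvPolynomial σ ℂ)) →ₐ[ℂ] ℂ :=
  IsLocalization.liftAlgHom (M := (vanishingIdeal ℂ {y} : Ideal (MvPolynomial σ ℂ)).primeCompl)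
    (f := aeval y) fun s => by
      have := s.2
      rw [Ideal.mem_primeCompl_iff, mem_vanishingIdeal_singleton_iff] at this
      exact isUnit_iff_ne_zero.2 this

@[simp]
lemma localEval_algebraMap (y : σ → ℂ) (f : MvPolynomial σ ℂ) :
    localEval y (algebraMap _ _ f) = eval y f := by
  simp [localEval]

/-- The directional derivative at `y` in the direction `v` on the local ring at `y`, packaged as
an algebra homomorphism to the dual numbers. -/
def localTangent (y v : σ → ℂ) :
    Localization.AtPrime (vanishingIdeal ℂ {y} : Ideal (MvPolynomial σ ℂ)) →ₐ[ℂ]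
      TrivSqZeroExt ℂ ℂ :=
  IsLocalization.liftAlgHom (M := (vanishingIdeal ℂ {y} : Ideal (MvPolynomial σ ℂ)).primeCompl)
    (f := aeval fun i => TrivSqZeroExt.inl (y i) + TrivSqZeroExt.inr (v i)) fun s => by
      have h := s.2
      rw [Ideal.mem_primeCompl_iff, mem_vanishingIdeal_singleton_iff] at h
      rw [TrivSqZeroExt.isUnit_iff_isUnit_fst]
      have : (TrivSqZeroExt.fstHom ℂ ℂ ℂ).comp
          (aeval fun i => TrivSqZeroExt.inl (y i) + TrivSqZeroExt.inr (v i)) = aeval y := by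
        ext i; simp
      have := congrArg (fun φ => φ (s : MvPolynomial σ ℂ)) this
      simp only [AlgHom.comp_apply, TrivSqZeroExt.fstHom_apply] at this
      rw [this]
      exact isUnit_iff_ne_zero.2 h

lemma localTangent_algebraMap (y v : σ → ℂ) (f : MvPolynomial σ ℂ) :
    localTangent y v (algebraMap _ _ f) =
      aeval (fun i => TrivSqZeroExt.inl (y i) + TrivSqZeroExt.inr (v i)) f := by
  simp [localTangent]

lemma fst_localTangent (y v : σ → ℂ) (f) : (localTangent y v f).fst = localEval y f := by
  have : (TrivSqZeroExt.fstHom ℂ ℂ ℂ).comp (localTangent y v) = localEval y := by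
    apply IsLocalization.algHom_ext
      (vanishingIdeal ℂ {y} : Ideal (MvPolynomial σ ℂ)).primeCompl
    ext i
    change (localTangent y v (algebraMap _ _ (X i))).fst = localEval y (algebraMap _ _ (X i))
    rw [localTangent_algebraMap, localEval_algebraMap]
    simp
  exact congrArg (fun φ => φ f) this

section Criterion

variable {I : Ideal (MvPolynomial σ ℂ)} {y : σ → ℂ}

lemma le_vanishingIdeal_of_mem_zeroLocus (hy : y ∈ zeroLocus ℂ I) :
    I ≤ vanishingIdeal ℂ {y} := by
  intro f hf
  rw [mem_vanishingIdeal_singleton_iff]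
  exact hy f hf

/-- The prime ideal of the coordinate ring of `V(I)` defined by one of its points. -/
def pointIdeal (I : Ideal (MvPolynomial σ ℂ)) (y : σ → ℂ) : Ideal (MvPolynomial σ ℂ ⧸ I) :=
  (vanishingIdeal ℂ {y} : Ideal (MvPolynomial σ ℂ)).map (Ideal.Quotient.mk I)

lemma comap_pointIdeal (hy : y ∈ zeroLocus ℂ I) :
    (pointIdeal I y).comap (Ideal.Quotient.mk I) = vanishingIdeal ℂ {y} :=
  Ideal.comap_map_mk (le_vanishingIdeal_of_mem_zeroLocus hy)

lemma isPrime_pointIdeal (hy : y ∈ zeroLocus ℂ I) : (pointIdeal I y).IsPrime :=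
  Ideal.map_isPrime_of_surjective Ideal.Quotient.mk_surjective
    (by rw [Ideal.mk_ker]; exact le_vanishingIdeal_of_mem_zeroLocus hy)

lemma isSmoothPoint_iff (hy : y ∈ zeroLocus ℂ I) :
    IsSmoothPoint I y ↔
      haveI := isPrime_pointIdeal hy
      Algebra.FormallySmooth ℂ (Localization.AtPrime (pointIdeal I y)) := by
  have hp := isPrime_pointIdeal hy
  constructor
  · rintro ⟨q, hq, h⟩
    have : q = ⟨pointIdeal I y, hp⟩ := by
      ext1
      rw [← comap_pointIdeal hy] at h
      exact Ideal.comap_injective_of_surjective _ Ideal.Quotient.mk_surjective h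
    subst this
    exact hq
  · exact fun h => ⟨⟨pointIdeal I y, hp⟩, h, comap_pointIdeal hy⟩

lemma derivation_eq_sum_pderiv [Fintype σ] {M : Type*} [AddCommGroup M] [Module ℂ M]
    [Module (MvPolynomial σ ℂ) M] [IsScalarTower ℂ (MvPolynomial σ ℂ) M]
    (d : Derivation ℂ (MvPolynomial σ ℂ) M) (f : MvPolynomial σ ℂ) :
    d f = ∑ i, pderiv i f • d (X i) := by
  classical
  induction f using MvPolynomial.induction_on with
  | C a => simp
  | add p q hp hq => simp only [map_add, hp, hq, add_smul, Finset.sum_add_distrib]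
  | mul_X p n hp =>
    rw [d.leibniz, hp]
    simp only [Derivation.leibniz, smul_eq_mul, add_smul, Finset.sum_add_distrib, mul_smul,
      Finset.smul_sum, pderiv_X, Pi.single_apply, ite_smul, one_smul, zero_smul, smul_ite,
      smul_zero, Finset.sum_ite_eq, Finset.mem_univ, if_true]

/-- The elementary form of the Jacobian criterion, for abstract localizations. -/
lemma formallySmooth_iff_grad [Finite σ] {P S : Type*} [CommRing P] [Algebra ℂ P]
    [Algebra (MvPolynomial σ ℂ) P] [IsScalarTower ℂ (MvPolynomial σ ℂ) P]
    [IsLocalization.AtPrime P (vanishingIdeal ℂ {y} : Ideal (MvPolynomial σ ℂ))]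
    [CommRing S] [IsLocalRing S] [Algebra ℂ S] (hy : y ∈ zeroLocus ℂ I)
    (φ : P →ₐ[ℂ] S) (hφ : Function.Surjective φ) (ε : P →ₐ[ℂ] ℂ)
    (hker : RingHom.ker φ = I.map (algebraMap (MvPolynomial σ ℂ) P))
    (hε : ∀ f, ε (algebraMap _ _ f) = eval y f)
    (hD : ∀ v : σ → ℂ, ∃ D : P →ₗ[ℂ] ℂ, (∀ a b, D (a * b) = ε a * D b + ε b * D a) ∧
      ∀ i, D (algebraMap _ _ (X i : MvPolynomial σ ℂ)) = v i) :
    Algebra.FormallySmooth ℂ S ↔ ∀ f ∈ I, grad y f = 0 →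
      ∃ h, eval y h ≠ 0 ∧ h * f ∈ (vanishingIdeal ℂ {y} : Ideal (MvPolynomial σ ℂ)) * I := by
  classical
  have := Fintype.ofFinite σ
  set m : Ideal (MvPolynomial σ ℂ) := vanishingIdeal ℂ {y} with hm
  have hmem : ∀ f, f ∈ m ↔ eval y f = 0 := fun f => mem_vanishingIdeal_singleton_iff y f
  let : Algebra P S := φ.toRingHom.toAlgebra
  let : Algebra P ℂ := ε.toRingHom.toAlgebra
  have hIε : RingHom.ker φ ≤ RingHom.ker ε := by
    rw [hker, Ideal.map_le_iff_le_comap]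
    intro f hf
    rw [Ideal.mem_comap, RingHom.mem_ker, hε]
    exact hy f hf
  let ψ : S →+* ℂ := RingHom.liftOfSurjective φ.toRingHom hφ ⟨ε.toRingHom, hIε⟩
  have hψ : ∀ a, ψ (φ a) = ε a := fun a =>
    RingHom.liftOfRightInverse_comp_apply φ.toRingHom _ _ ⟨ε.toRingHom, hIε⟩ a
  let : Algebra S ℂ := ψ.toAlgebra
  have : IsScalarTower ℂ P S := .of_algebraMap_eq fun c => (φ.commutes c).symm
  have : IsScalarTower P S ℂ := .of_algebraMap_eq fun a => (hψ a).symm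
  have : Algebra.FormallySmooth ℂ P := by
    have : Algebra.FormallySmooth (MvPolynomial σ ℂ) P := .of_isLocalization m.primeCompl
    exact .comp ℂ (MvPolynomial σ ℂ) P
  have : Algebra.EssFiniteType (MvPolynomial σ ℂ) P := .of_isLocalization _ m.primeCompl
  have : Algebra.EssFiniteType ℂ P := .comp _ (MvPolynomial σ ℂ) _
  have : IsLocalRing P := IsLocalization.AtPrime.isLocalRing P m
  have : Module.Free P Ω[P⁄ℂ] := Module.free_of_flat_of_isLocalRing
  have hker' : RingHom.ker (algebraMap P S) = I.map (algebraMap (MvPolynomial σ ℂ) P) := hker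
  have : IsNoetherianRing P := IsLocalization.isNoetherianRing m.primeCompl _ inferInstance
  have hεs : Function.Surjective (algebraMap P ℂ) := fun z => ⟨algebraMap ℂ P z, ε.commutes z⟩
  have hψmax : IsLocalRing.maximalIdeal S ≤ RingHom.ker (algebraMap S ℂ) := by
    have : Function.Surjective ψ := fun z => ⟨φ (algebraMap ℂ P z), by
      rw [hψ]; exact ε.commutes z⟩
    have := RingHom.ker_isMaximal_of_surjective ψ this
    exact (IsLocalRing.eq_maximalIdeal this).ge
  -- Smoothness means that the fibre at the point of `J/J² → Ω[P⁄ℂ] ⊗ S`, with `J` the kernel of `P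
  -- → S`, is injective. Below, the source is read as `J/mJ` and the map as the gradient.
  rw [Algebra.FormallySmooth.iff_injective_cotangentComplexBaseChange P ℂ hφ
    (IsNoetherian.noetherian _) hψmax]
  -- the elements `1 ⊗ f` of the source
  have hmemI : ∀ f ∈ I, algebraMap _ P f ∈ RingHom.ker (algebraMap P S) := fun f hf => by
    rw [hker']; exact Ideal.mem_map_of_mem _ hf
  have hone : ∀ {M : Type _} [AddCommGroup M] [Module P M] (f : MvPolynomial σ ℂ) (x : M),
      (1 : ℂ) ⊗ₜ[P] (algebraMap _ P f • x) = eval y f ⊗ₜ[P] x := by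
    intro M _ _ f x
    rw [← smul_tmul, Algebra.smul_def, mul_one]
    exact congrArg (· ⊗ₜ[P] x) (hε f)
  have hDf : ∀ f, (1 : ℂ) ⊗ₜ[P] D ℂ P (algebraMap _ P f) =
      ∑ i, grad y f i ⊗ₜ[P] D ℂ P (algebraMap _ P (X i : MvPolynomial σ ℂ)) := by
    intro f
    have : D ℂ P (algebraMap _ P f) = _ :=
      derivation_eq_sum_pderiv ((D ℂ P).compAlgebraMap (MvPolynomial σ ℂ)) f
    rw [this, tmul_sum]
    refine Finset.sum_congr rfl fun i _ => ?_
    rw [← algebraMap_smul P, hone, grad_apply]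
    rfl
  have hD1 : ∀ f, grad y f = 0 → (1 : ℂ) ⊗ₜ[P] D ℂ P (algebraMap _ P f) = 0 := by
    intro f hf
    rw [hDf, hf]
    simp
  -- The derivations supplied by `hD` separate the differentials of the coordinates, so no relation
  -- among these can hide a nonzero gradient.
  have hD2 : ∀ f, (1 : ℂ) ⊗ₜ[P] D ℂ P (algebraMap _ P f) = 0 → grad y f = 0 := by
    intro f hf
    ext i
    obtain ⟨d, hd, hdX⟩ := hD (Pi.single i 1)
    let d' : Derivation ℂ P ℂ := Derivation.mk' d hd
    rw [hDf] at hf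
    have h1 := congrArg (LinearMap.liftBaseChange ℂ d'.liftKaehlerDifferential) hf
    simp only [map_sum, LinearMap.liftBaseChange_tmul, map_zero,
      Derivation.liftKaehlerDifferential_comp_D] at h1
    have h2 : ∀ j, d' (algebraMap _ P (X j : MvPolynomial σ ℂ)) = Pi.single (M := fun _ => ℂ) i 1 j :=
      hdX
    simpa [h2, Pi.single_apply] using h1
  have hT : ∀ f (hf : f ∈ I), (1 : ℂ) ⊗ₜ[P]
        (⟨algebraMap _ P f, hmemI f hf⟩ : RingHom.ker (algebraMap P S)) = 0 ↔
      ∃ h, eval y h ≠ 0 ∧ h * f ∈ m * I := by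
    intro f hf
    let e : (P ⧸ RingHom.ker ε) ≃ₗ[P] ℂ :=
      LinearMap.quotKerEquivOfSurjective (Algebra.linearMap P ℂ) hεs
    let E := (TensorProduct.congr e (LinearEquiv.refl P (RingHom.ker (algebraMap P S)))).symm ≪≫ₗ
      TensorProduct.quotTensorEquivQuotSMul _ (RingHom.ker ε)
    have hE : ∀ x, E ((1 : ℂ) ⊗ₜ[P] x) = Submodule.Quotient.mk x := by
      intro x
      have : e.symm 1 = Ideal.Quotient.mk _ 1 := by
        rw [LinearEquiv.symm_apply_eq]
        exact (map_one (algebraMap P ℂ)).symm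
      simp only [E, LinearEquiv.trans_apply, congr_symm_tmul, this, LinearEquiv.refl_symm,
        LinearEquiv.refl_apply, quotTensorEquivQuotSMul_mk_tmul, one_smul]
    have hkerε : RingHom.ker ε = m.map (algebraMap _ P) := by
      have := RingHom.ker_isMaximal_of_surjective ε hεs
      rw [IsLocalization.AtPrime.map_eq_maximalIdeal m P]
      exact IsLocalRing.eq_maximalIdeal this
    have hmap : Submodule.map (Submodule.subtype (RingHom.ker (algebraMap P S)))
        (RingHom.ker ε • ⊤) = (m * I).map (algebraMap _ P) := by
      rw [Submodule.map_smul'', Submodule.map_top, Submodule.range_subtype, smul_eq_mul,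
        Ideal.map_mul, hkerε, hker']
    have hmem' : ∀ x : RingHom.ker (algebraMap P S),
        x ∈ (RingHom.ker ε • ⊤ : Submodule P (RingHom.ker (algebraMap P S))) ↔
          (x : P) ∈ (m * I).map (algebraMap _ P) := by
      intro x
      rw [← hmap]
      refine ⟨fun h => ⟨x, h, rfl⟩, ?_⟩
      rintro ⟨x', h, he⟩
      rwa [← Subtype.ext he]
    rw [← E.map_eq_zero_iff, hE, Submodule.Quotient.mk_eq_zero, hmem',
      IsLocalization.mem_map_algebraMap_iff m.primeCompl P]
    constructor
    · rintro ⟨⟨⟨a, ha⟩, s⟩, hs⟩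
      simp only [← map_mul] at hs
      obtain ⟨c, hc⟩ := (IsLocalization.eq_iff_exists m.primeCompl P).1 hs
      refine ⟨c * s, ?_, ?_⟩
      · rw [map_mul]
        exact mul_ne_zero (fun h0 => c.2 ((hmem _).2 h0)) (fun h0 => s.2 ((hmem _).2 h0))
      · rw [mul_assoc, mul_comm (s : MvPolynomial σ ℂ), hc]
        exact Ideal.mul_mem_left _ _ ha
    · rintro ⟨h, h0, hh⟩
      refine ⟨⟨⟨_, hh⟩, ⟨h, fun h' => h0 ((hmem _).1 h')⟩⟩, ?_⟩
      simp only [map_mul, mul_comm]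
  have hsurj : ∀ z : ℂ ⊗[P] RingHom.ker (algebraMap P S), ∃ c : ℂ, c ≠ 0 ∧ ∃ f, ∃ hf : f ∈ I,
      c • z = (1 : ℂ) ⊗ₜ[P] ⟨algebraMap _ P f, hmemI f hf⟩ := by
    intro z
    obtain ⟨⟨x, hx⟩, rfl⟩ := TensorProduct.mk_surjective P _ ℂ hεs z
    have hx' := hx
    rw [hker', IsLocalization.mem_map_algebraMap_iff m.primeCompl P] at hx'
    obtain ⟨⟨⟨f, hf⟩, s⟩, hs⟩ := hx'
    refine ⟨eval y s, fun h0 => s.2 ((hmem _).2 h0), f, hf, ?_⟩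
    rw [TensorProduct.mk_apply, smul_tmul', smul_eq_mul, mul_one, ← hone]
    congr 1
    ext1
    rw [mul_comm] at hs
    exact hs
  rw [injective_iff_map_eq_zero]
  constructor
  · intro H f hf h0
    rw [← hT f hf]
    apply H
    rw [cotangentComplexBaseChange_tmul]
    simp only [kerToTensor_apply, one_smul]
    exact hD1 f h0
  · intro H z hz
    obtain ⟨c, hc, f, hf, hcz⟩ := hsurj z
    have : c • z = 0 := by
      rw [hcz, hT _ hf]
      apply H f hf
      apply hD2
      have := congrArg (c • ·) hz
      simp only [← map_smul, hcz, cotangentComplexBaseChange_tmul] at this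
      simpa using this
    exact (smul_eq_zero.1 this).resolve_left hc

/-- The elementary form of the Jacobian criterion at a closed point. -/
theorem isSmoothPoint_iff_grad [Finite σ] (hy : y ∈ zeroLocus ℂ I) :
    IsSmoothPoint I y ↔ ∀ f ∈ I, grad y f = 0 →
      ∃ h, eval y h ≠ 0 ∧ h * f ∈ (vanishingIdeal ℂ {y} : Ideal (MvPolynomial σ ℂ)) * I := by
  rw [isSmoothPoint_iff hy]
  have hp := isPrime_pointIdeal hy
  have hmem : ∀ f, Ideal.Quotient.mk I f ∈ pointIdeal I y ↔
      f ∈ (vanishingIdeal ℂ {y} : Ideal (MvPolynomial σ ℂ)) := fun f => by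
    rw [← comap_pointIdeal hy, Ideal.mem_comap]
  let φ : Localization.AtPrime (vanishingIdeal ℂ {y} : Ideal (MvPolynomial σ ℂ)) →ₐ[ℂ]
      Localization.AtPrime (pointIdeal I y) :=
    { Localization.localRingHom (vanishingIdeal ℂ {y}) (pointIdeal I y) (Ideal.Quotient.mk I)
        (comap_pointIdeal hy).symm with
      commutes' := fun c => by
        change Localization.localRingHom (vanishingIdeal ℂ {y}) (pointIdeal I y)
          (Ideal.Quotient.mk I) (comap_pointIdeal hy).symm
          (algebraMap (MvPolynomial σ ℂ) _ (algebraMap ℂ _ c)) = _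
        rw [Localization.localRingHom_to_map]
        rfl }
  have hφmk : ∀ f (s : (vanishingIdeal ℂ {y} : Ideal (MvPolynomial σ ℂ)).primeCompl),
      φ (IsLocalization.mk' _ f s) = IsLocalization.mk' _ (Ideal.Quotient.mk I f)
        (⟨Ideal.Quotient.mk I s, fun h => s.2 ((hmem _).1 h)⟩ : (pointIdeal I y).primeCompl) :=
    fun f s => Localization.localRingHom_mk' _ _ _ (comap_pointIdeal hy).symm f s
  refine formallySmooth_iff_grad hy φ ?_ (localEval y) ?_ (localEval_algebraMap y) ?_
  · intro z
    obtain ⟨a, s, rfl⟩ := IsLocalization.exists_mk'_eq (pointIdeal I y).primeCompl z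
    obtain ⟨a, rfl⟩ := Ideal.Quotient.mk_surjective a
    obtain ⟨s, hs⟩ := s
    obtain ⟨s, rfl⟩ := Ideal.Quotient.mk_surjective s
    exact ⟨IsLocalization.mk' _ a (⟨s, fun h => hs ((hmem _).2 h)⟩ :
      (vanishingIdeal ℂ {y} : Ideal (MvPolynomial σ ℂ)).primeCompl), hφmk _ _⟩
  · ext z
    obtain ⟨a, s, rfl⟩ := IsLocalization.exists_mk'_eq
      (vanishingIdeal ℂ {y} : Ideal (MvPolynomial σ ℂ)).primeCompl z
    rw [RingHom.mem_ker, hφmk, IsLocalization.mk'_eq_zero_iff,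
      IsLocalization.mk'_mem_map_algebraMap_iff (vanishingIdeal ℂ {y}).primeCompl]
    constructor
    · rintro ⟨⟨c, hc⟩, h⟩
      obtain ⟨c, rfl⟩ := Ideal.Quotient.mk_surjective c
      refine ⟨c, fun h => hc ((hmem _).2 h), ?_⟩
      rwa [← map_mul, Ideal.Quotient.eq_zero_iff_mem] at h
    · rintro ⟨c, hc, h⟩
      refine ⟨⟨Ideal.Quotient.mk I c, fun h => hc ((hmem _).1 h)⟩, ?_⟩
      rwa [← map_mul, Ideal.Quotient.eq_zero_iff_mem]
  · intro v
    refine ⟨(TrivSqZeroExt.sndHom ℂ ℂ).comp (localTangent y v).toLinearMap, fun a b => ?_, fun i => ?_⟩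
    · simp [fst_localTangent, mul_comm]
    · change (localTangent y v (algebraMap _ _ (X i : MvPolynomial σ ℂ))).snd = v i
      rw [localTangent_algebraMap]
      simp

lemma grad_mul (y : σ → ℂ) (f g : MvPolynomial σ ℂ) :
    grad y (f * g) = eval y f • grad y g + eval y g • grad y f := by
  ext i
  simp [Derivation.leibniz]

/-- **Jacobian criterion**: a point at which the equations have independent gradients is smooth. -/
theorem isSmoothPoint_of_linearIndependent [Finite σ] {κ : Type*} [Fintype κ]
    (f : κ → MvPolynomial σ ℂ) (hy : ∀ k, eval y (f k) = 0)
    (hf : LinearIndependent ℂ fun k => grad y (f k)) :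
    IsSmoothPoint (Ideal.span (Set.range f)) y := by
  rw [isSmoothPoint_iff_grad (by rw [zeroLocus_span]; rintro _ ⟨k, rfl⟩; exact hy k)]
  intro g hg h0
  refine ⟨1, by simp, ?_⟩
  rw [one_mul]
  obtain ⟨a, rfl⟩ := (Ideal.mem_span_range_iff_exists_fun).1 hg
  have : ∑ k, eval y (a k) • grad y (f k) = 0 := by
    rw [← h0, map_sum]
    refine Finset.sum_congr rfl fun k _ => ?_
    rw [grad_mul, hy, zero_smul, add_zero]
  rw [Fintype.linearIndependent_iff] at hf
  refine Ideal.sum_mem _ fun k _ => Ideal.mul_mem_mul ?_ (Ideal.subset_span ⟨k, rfl⟩)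
  exact (mem_vanishingIdeal_singleton_iff y _).2 (hf _ this k)

/-- Near a smooth point, an ideal is generated by any of its elements whose gradients span the
gradients of all of its elements. -/
theorem IsSmoothPoint.exists_mul_mem_span [Finite σ] (hy : y ∈ zeroLocus ℂ I)
    (h : IsSmoothPoint I y) {F : Set (MvPolynomial σ ℂ)} (hF : F ⊆ I)
    (hd : ∀ f ∈ I, grad y f ∈ Submodule.span ℂ (grad y '' F)) {f : MvPolynomial σ ℂ}
    (hf : f ∈ I) : ∃ h, eval y h ≠ 0 ∧ h * f ∈ Ideal.span F := by
  rw [isSmoothPoint_iff_grad hy] at h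
  set m : Ideal (MvPolynomial σ ℂ) := vanishingIdeal ℂ {y}
  have hmem : ∀ f, f ∈ m ↔ eval y f = 0 := fun f => mem_vanishingIdeal_singleton_iff y f
  let P := Localization.AtPrime m
  let θ := algebraMap (MvPolynomial σ ℂ) P
  -- Nakayama in the local ring: an element of `I` differs from one of `span F` by an element with
  -- zero gradient, which lies in `m I` locally because the point is smooth.
  have hle : I.map θ ≤ (Ideal.span F).map θ := by
    apply Submodule.le_of_le_smul_of_le_jacobson_bot (I := IsLocalRing.maximalIdeal P)
      (IsNoetherian.noetherian _) (IsLocalRing.maximalIdeal_le_jacobson _)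
    rw [Ideal.map_le_iff_le_comap]
    intro g hg
    have hg' := hd g hg
    rw [← Submodule.map_span] at hg'
    obtain ⟨g₀, hg₀, he⟩ := hg'
    have hspan : g₀ ∈ Ideal.span F :=
      (Submodule.span_le_restrictScalars ℂ (MvPolynomial σ ℂ) F) hg₀
    obtain ⟨c, hc, hcg⟩ := h (g - g₀) (I.sub_mem hg (Ideal.span_le.2 hF hspan))
      (by rw [map_sub, he, sub_self])
    have hunit : IsUnit (θ c) := IsLocalization.map_units P
      (⟨c, fun h => hc ((hmem _).1 h)⟩ : m.primeCompl)
    have h1 : θ (g - g₀) ∈ IsLocalRing.maximalIdeal P • I.map θ := by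
      rw [← Ideal.unit_mul_mem_iff_mem _ hunit, ← map_mul, smul_eq_mul,
        ← Localization.AtPrime.map_eq_maximalIdeal, ← Ideal.map_mul]
      exact Ideal.mem_map_of_mem _ hcg
    rw [Ideal.mem_comap, ← sub_add_cancel g g₀, map_add, add_comm]
    exact Submodule.add_mem_sup (Ideal.mem_map_of_mem _ hspan) h1
  have := hle (Ideal.mem_map_of_mem _ hf)
  rw [IsLocalization.algebraMap_mem_map_algebraMap_iff m.primeCompl] at this
  obtain ⟨c, hc, hcf⟩ := this
  exact ⟨c, fun h => hc ((hmem _).2 h), hcf⟩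

/-- If the gradients at a smooth point of `V(I)` of all the elements of `I` are multiples of that
of `f₀ ∈ I`, then `I` has height at most one. -/
theorem IsSmoothPoint.height_le_one [Finite σ] (hy : y ∈ zeroLocus ℂ I)
    (h : IsSmoothPoint I y) {f₀ : MvPolynomial σ ℂ} (hf₀ : f₀ ∈ I)
    (hd : ∀ f ∈ I, grad y f ∈ Submodule.span ℂ {grad y f₀}) : I.height ≤ 1 := by
  have key : ∀ f ∈ I, ∃ h, eval y h ≠ 0 ∧ h * f ∈ Ideal.span {f₀} := fun f hf =>
    h.exists_mul_mem_span hy (Set.singleton_subset_iff.2 hf₀)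
      (by simpa only [Set.image_singleton] using hd) hf
  have hle := le_vanishingIdeal_of_mem_zeroLocus hy
  -- A minimal prime of `(f₀)` inside the ideal of the point contains all of `I`, as the local
  -- denominators do not vanish at the point. Krull's principal ideal theorem bounds its height.
  obtain ⟨p, hp, hpm⟩ := Ideal.exists_minimalPrimes_le
    ((Ideal.span_singleton_le_iff_mem _).2 (hle hf₀))
  have := hp.1.1
  have hIp : I ≤ p := by
    intro f hf
    obtain ⟨c, hc, hcf⟩ := key f hf
    refine (this.mem_or_mem (hp.1.2 hcf)).resolve_left fun hcp => hc ?_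
    exact (mem_vanishingIdeal_singleton_iff y c).1 (hpm hcp)
  refine (Ideal.height_mono hIp).trans ?_
  exact Ideal.height_le_one_of_isPrincipal_of_mem_minimalPrimes _ p hp

end Criterion

end Smooth

/-! ### Rank, minors and left kernels -/

section MatrixRank

variable {K : Type*} [Field K]

lemma exists_rows_linearIndependent {m n : Type*} [Fintype m] [Fintype n] (A : Matrix m n K)
    {r : ℕ} (hr : A.rank = r) : ∃ f : Fin r → m, LinearIndependent K (A.submatrix f id).row ∧
      Submodule.span K (Set.range (A.submatrix f id).row) =
        Submodule.span K (Set.range A.row) := by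
  obtain ⟨κ, a, ha, hspan, hli⟩ := exists_linearIndependent' K A.row
  have : Finite κ := Finite.of_injective a ha
  have := Fintype.ofFinite κ
  have hcard : Fintype.card κ = r := by
    rw [← hr, Matrix.rank_eq_finrank_span_row, ← hspan, finrank_span_eq_card hli]
  let e := Fintype.equivFinOfCardEq hcard
  refine ⟨a ∘ e.symm, hli.comp _ e.symm.injective, ?_⟩
  rw [← hspan]
  congr 1
  exact (e.symm.surjective.range_comp (A.row ∘ a))

lemma exists_submatrix_det_ne_zero {m n : Type*} [Fintype m] [Fintype n] (A : Matrix m n K)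
    {r : ℕ} (hr : A.rank = r) : ∃ (f : Fin r → m) (g : Fin r → n), (A.submatrix f g).det ≠ 0 := by
  obtain ⟨f, hf, -⟩ := exists_rows_linearIndependent A hr
  have h1 : (A.submatrix f id).transpose.rank = r := by
    rw [Matrix.rank_transpose]
    simpa using hf.rank_matrix
  obtain ⟨g, hg, -⟩ := exists_rows_linearIndependent (A.submatrix f id).transpose h1
  refine ⟨f, g, ?_⟩
  rw [← Matrix.det_transpose, ← isUnit_iff_ne_zero, ← Matrix.isUnit_iff_isUnit_det,
    ← Matrix.linearIndependent_rows_iff_isUnit]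
  exact hg

lemma le_rank_of_submatrix_det_ne_zero {m n : Type*} [Fintype m] [Fintype n] (A : Matrix m n K)
    {r : ℕ} (f : Fin r → m) (g : Fin r → n) (h : (A.submatrix f g).det ≠ 0) : r ≤ A.rank := by
  have := Matrix.rank_of_det_ne_zero h
  rw [Fintype.card_fin] at this
  exact this ▸ Matrix.rank_submatrix_le A f g

lemma rank_eq_card_iff_vecMul {m n : Type*} [Fintype m] [Fintype n] (A : Matrix m n K) :
    A.rank = Fintype.card m ↔ ∀ v, Matrix.vecMul v A = 0 → v = 0 := by
  rw [Matrix.rank_eq_finrank_span_row, ← Set.finrank, eq_comm,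
    ← linearIndependent_iff_card_eq_finrank_span, ← Matrix.vecMul_injective_iff]
  exact injective_iff_map_eq_zero A.vecMulLinear

lemma submatrix_det_eq_zero_iff_exists_vecMul {m n : ℕ} (A : Matrix (Fin m) (Fin n) K) :
    (∀ (f : Fin m → Fin m) (g : Fin m → Fin n), (A.submatrix f g).det = 0) ↔
      ∃ v, v ≠ 0 ∧ Matrix.vecMul v A = 0 := by
  have h := rank_eq_card_iff_vecMul A
  rw [Fintype.card_fin] at h
  constructor
  · intro H
    by_contra! hv
    have hr := h.2 fun v hv' => by
      by_contra h0
      exact hv v h0 hv'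
    obtain ⟨f, g, hfg⟩ := exists_submatrix_det_ne_zero A hr
    exact hfg (H f g)
  · rintro ⟨v, hv, hv'⟩ f g
    by_contra hne
    have := le_rank_of_submatrix_det_ne_zero A f g hne
    exact hv (h.1 (le_antisymm (A.rank_le_height) this) v hv')

end MatrixRank

/-- By the Leibniz rule, the derivatives of the coefficients disappear at a common zero of the
generators. -/
lemma grad_mem_span_of_mem_span {σ : Type*} {y : σ → ℂ} {G : Set (MvPolynomial σ ℂ)}
    (hG : ∀ g ∈ G, eval y g = 0) {f : MvPolynomial σ ℂ} (hf : f ∈ Ideal.span G) :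
    grad y f ∈ Submodule.span ℂ (grad y '' G) := by
  have hle : Ideal.span G ≤ RingHom.ker (eval y) := Ideal.span_le.2 hG
  induction hf using Submodule.span_induction with
  | mem x hx => exact Submodule.subset_span ⟨x, hx, rfl⟩
  | zero => simp
  | add x z _ _ hx hz => rw [map_add]; exact add_mem hx hz
  | smul a x hx hx' =>
    have h0 : eval y x = 0 := hle hx
    rw [smul_eq_mul, grad_mul, h0, zero_smul, add_zero]
    exact Submodule.smul_mem _ _ hx'

/-! ### Equations of the graph closure and of the Tjurina transform -/

section Equations

/-- The equations, in the chart `s i = 1`, of the closure of the graph of the column span map. -/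
def graphEqn {m n : ℕ} (i : Fin m) :
    Option (Fin n) → MvPolynomial ((Fin m × Fin n) ⊕ Fin m) ℂ
  | none => X (Sum.inr i) - 1
  | some b => ∑ a, X (Sum.inr a) * X (Sum.inl (a, b))

/-- The equations, in the chart `s i = 1`, of the Tjurina transform. -/
def tjurinaEqn {m n k : ℕ} (F : Matrix (Fin m) (Fin n) (MvPolynomial (Fin k) ℂ)) (i : Fin m) :
    Option (Fin n) → MvPolynomial (Fin k ⊕ Fin m) ℂ
  | none => X (Sum.inr i) - 1
  | some b => ∑ a, X (Sum.inr a) * rename Sum.inl (F a b)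

/-- The polynomial parametrization of the closure of the graph. -/
def graphParam {m n : ℕ} (i : Fin m) :
    (Fin m × Fin n) ⊕ Fin m → MvPolynomial ((Fin m × Fin n) ⊕ Fin m) ℂ
  | Sum.inl p => if p.1 = i then
      -∑ a ∈ Finset.univ.erase i, X (Sum.inr a) * X (Sum.inl (a, p.2)) else X (Sum.inl p)
  | Sum.inr a => if a = i then 1 else X (Sum.inr a)

/-- Where `s i = 1`, the bilinear equations solve for the `i`-th row of the matrix in terms of the
other rows and `s`, so every polynomial is congruent to one in the free coordinates. -/
lemma mk_graphParam {m n : ℕ} (i : Fin m) (f : MvPolynomial ((Fin m × Fin n) ⊕ Fin m) ℂ) :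
    Ideal.Quotient.mk (Ideal.span (Set.range (graphEqn (n := n) i))) (aeval (graphParam i) f) =
      Ideal.Quotient.mk _ f := by
  have : ((Ideal.Quotient.mkₐ ℂ (Ideal.span (Set.range (graphEqn (n := n) i)))).comp
      (aeval (graphParam i))) = Ideal.Quotient.mkₐ ℂ _ := by
    have h0 : X (Sum.inr i) - 1 ∈ Ideal.span (Set.range (graphEqn (n := n) i)) :=
      Ideal.subset_span ⟨none, rfl⟩
    ext z
    simp only [AlgHom.comp_apply, aeval_X, Ideal.Quotient.mkₐ_eq_mk]
    rw [Ideal.Quotient.eq]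
    rcases z with ⟨a, b⟩ | a
    · rcases eq_or_ne a i with rfl | h
      · have h1 : graphEqn a (some b) ∈ Ideal.span (Set.range (graphEqn (n := n) a)) :=
          Ideal.subset_span ⟨some b, rfl⟩
        have h2 := Ideal.sub_mem _ (Ideal.mul_mem_right (X (Sum.inl (a, b))) _ h0) h1
        convert! h2 using 1
        simp only [graphParam, if_true, graphEqn]
        rw [← Finset.add_sum_erase _ _ (Finset.mem_univ a)]
        ring
      · simp [graphParam, h]
    · rcases eq_or_ne a i with rfl | h
      · have := Ideal.neg_mem_iff _ |>.2 h0
        simpa [graphParam] using this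
      · simp [graphParam, h]
  exact congrArg (fun φ => φ f) this

/-- A parametrized point has a nonzero left kernel vector, hence rank at most `t`. The nonvanishing
minor, taken from the rows other than `i`, gives rank at least `t`. -/
lemma eval_graphParam_mem {t : ℕ} (i : Fin (t + 1))
    (w : (Fin (t + 1) × Fin (t + 2)) ⊕ Fin (t + 1) → ℂ)
    (hw : (Matrix.of fun a b : Fin t =>
      w (Sum.inl (i.succAbove a, b.castSucc.castSucc))).det ≠ 0) :
    (fun z => eval w (graphParam i z)) ∈ graphChart (t + 1) (t + 2) i := by
  have h2 : ∀ b, ∑ a, eval w (graphParam i (Sum.inr a : (Fin (t + 1) × Fin (t + 2)) ⊕ _)) *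
      eval w (graphParam i (Sum.inl (a, b))) = 0 := by
    intro b
    rw [← Finset.add_sum_erase _ _ (Finset.mem_univ i)]
    have : ∀ a ∈ Finset.univ.erase i,
        eval w (graphParam i (Sum.inr a : (Fin (t + 1) × Fin (t + 2)) ⊕ _)) *
        eval w (graphParam i (Sum.inl (a, b))) = w (Sum.inr a) * w (Sum.inl (a, b)) := by
      intro a ha
      simp [graphParam, Finset.ne_of_mem_erase ha]
    rw [Finset.sum_congr rfl this]
    simp [graphParam]
  refine ⟨le_antisymm ?_ ?_, by simp [graphParam], h2⟩
  · set B : Matrix (Fin (t + 1)) (Fin (t + 2)) ℂ :=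
      Matrix.of fun a b => eval w (graphParam i (Sum.inl (a, b))) with hB
    change B.rank + 1 ≤ t + 1
    have hle := B.rank_le_height
    have hne : B.rank ≠ t + 1 := by
      intro h
      have := (rank_eq_card_iff_vecMul B).1 (by rw [h, Fintype.card_fin])
        (fun a => eval w (graphParam i (Sum.inr a : (Fin (t + 1) × Fin (t + 2)) ⊕ _))) (by
          ext b
          exact h2 b)
      have := congrFun this i
      simp [graphParam] at this
    omega
  · rw [add_le_add_iff_right]
    apply le_rank_of_submatrix_det_ne_zero _ i.succAbove fun b : Fin t => b.castSucc.castSucc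
    convert! hw using 2
    ext a b
    simp [graphParam, Fin.succAbove_ne]

/-- The graph contains the image of a dense open subset of the parameter space. A polynomial
vanishing on it thus pulls back to zero, and by `mk_graphParam` it is zero modulo the equations. -/
theorem vanishingIdeal_graphChart {t : ℕ} (i : Fin t) :
    vanishingIdeal ℂ (graphChart t (t + 1) i) = Ideal.span (Set.range (graphEqn i)) := by
  apply le_antisymm
  · intro f hf
    rw [← Ideal.Quotient.eq_zero_iff_mem, ← mk_graphParam]
    suffices aeval (graphParam i) f = 0 by rw [this, map_zero]
    obtain ⟨t, rfl⟩ : ∃ k, t = k + 1 := ⟨t - 1, by have := i.pos; omega⟩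
    let e : Fin t × Fin t → (Fin (t + 1) × Fin (t + 2)) ⊕ Fin (t + 1) :=
      fun p => Sum.inl (i.succAbove p.1, p.2.castSucc.castSucc)
    have he : Function.Injective e := by
      rintro ⟨a, b⟩ ⟨a', b'⟩ h
      simpa [e] using h
    have hD : rename e (Matrix.mvPolynomialX (Fin t) (Fin t) ℂ).det ≠ 0 := by
      rw [Ne, map_eq_zero_iff _ (rename_injective _ he)]
      exact Matrix.det_mvPolynomialX_ne_zero (Fin t) ℂ
    refine (mul_eq_zero.1 (?_ : _ * aeval (graphParam i) f = 0)).resolve_left hD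
    apply MvPolynomial.funext
    intro w
    rw [map_mul, map_zero]
    by_contra hne
    obtain ⟨h1, h2⟩ := mul_ne_zero_iff.1 hne
    apply h2
    have := hf _ (eval_graphParam_mem i w (by
      rw [eval_rename, RingHom.map_det] at h1
      convert! h1 using 2
      ext a b
      simp [Matrix.mvPolynomialX, e]))
    rw [← this, ← aeval_eq_eval, ← comp_aeval_apply]
  · rw [Ideal.span_le]
    rintro _ ⟨o, rfl⟩ z ⟨-, hz1, hz2⟩
    cases o with
    | none => simp [graphEqn, hz1]
    | some b => simpa [graphEqn] using hz2 b

theorem tjurinaIdeal_eq_span {t k : ℕ}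
    (F : Matrix (Fin t) (Fin (t + 1)) (MvPolynomial (Fin k) ℂ)) (i : Fin t) :
    tjurinaIdeal F i = Ideal.span (Set.range (tjurinaEqn F i)) := by
  rw [tjurinaIdeal, vanishingIdeal_graphChart, Ideal.map_span, ← Set.range_comp]
  congr 2
  funext o
  cases o <;> simp [graphEqn, tjurinaEqn]

end Equations

/-! ### The bilinear form in `s` and `x` -/

section Evaluation

/-- The value at a point of the matrix of linear forms with the given coefficients. -/
def evalMatrix {m n k : ℕ} (c : LinCoeff m n k) (x : Fin k → ℂ) : Matrix (Fin m) (Fin n) ℂ :=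
  Matrix.of fun i j => ∑ l, c (i, j, l) * x l

lemma eval_linMatrix {m n k : ℕ} (c : LinCoeff m n k) (x : Fin k → ℂ) (i : Fin m) (j : Fin n) :
    eval x (linMatrix c i j) = evalMatrix c x i j := by
  simp [linMatrix, evalMatrix]

lemma evalMatrix_smul {m n k : ℕ} (c : LinCoeff m n k) (τ : ℂ) (x : Fin k → ℂ) :
    evalMatrix c (τ • x) = τ • evalMatrix c x := by
  ext i j
  simp [evalMatrix, Finset.mul_sum, mul_left_comm]

/-- The two ways to evaluate the bilinear form. -/
lemma vecMul_evalMatrix {t N : ℕ} (c : LinCoeff t (t + 1) N) (s : Fin t → ℂ) (x : Fin N → ℂ) :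
    Matrix.vecMul s (evalMatrix c x) = Matrix.mulVec (evalMatrix (derivCoeff c) s) x := by
  ext b
  simp only [Matrix.vecMul, dotProduct, Matrix.mulVec, evalMatrix, derivCoeff, Matrix.of_apply,
    Finset.mul_sum, Finset.sum_mul]
  rw [Finset.sum_comm]
  exact Finset.sum_congr rfl fun _ _ => Finset.sum_congr rfl fun _ _ => by ring

end Evaluation

/-! ### Smooth points of the Tjurina transform -/

section TjurinaPoints

variable {t N : ℕ} (c : LinCoeff t (t + 1) N) (i : Fin t) (x : Fin N → ℂ) (s : Fin t → ℂ)

lemma eval_tjurinaEqn_some (b : Fin (t + 1)) :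
    eval (Sum.elim x s) (tjurinaEqn (linMatrix c) i (some b)) =
      Matrix.vecMul s (evalMatrix c x) b := by
  simp only [tjurinaEqn, map_sum, map_mul, eval_X, Sum.elim_inr, Matrix.vecMul, dotProduct]
  refine Finset.sum_congr rfl fun a _ => ?_
  rw [eval_rename, ← eval_linMatrix]
  rfl

lemma grad_tjurinaEqn_none :
    grad (Sum.elim x s) (tjurinaEqn (linMatrix c) i none) = Pi.single (Sum.inr i) 1 := by
  ext z
  simp [tjurinaEqn, Pi.single_apply, eq_comm]

lemma grad_tjurinaEqn_some (b : Fin (t + 1)) :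
    grad (Sum.elim x s) (tjurinaEqn (linMatrix c) i (some b)) =
      Sum.elim (evalMatrix (derivCoeff c) s b) fun a => evalMatrix c x a b := by
  ext z
  rcases z with l | a
  · simp [tjurinaEqn, linMatrix, evalMatrix, derivCoeff, Derivation.leibniz, Pi.single_apply,
      mul_comm]
  · simp [tjurinaEqn, linMatrix, evalMatrix, Derivation.leibniz, Pi.single_apply]

variable {i x s}

lemma mem_zeroLocus_tjurinaIdeal_iff :
    Sum.elim x s ∈ zeroLocus ℂ (tjurinaIdeal (linMatrix c) i) ↔
      s i = 1 ∧ Matrix.vecMul s (evalMatrix c x) = 0 := by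
  rw [tjurinaIdeal_eq_span, zeroLocus_span]
  simp only [Set.mem_ofPred_eq, Set.forall_mem_range, Option.forall, aeval_eq_eval,
    eval_tjurinaEqn_some, funext_iff]
  simp [tjurinaEqn, sub_eq_zero]

/-- The hypothesis `h` is independence of the Jacobian rows of the bilinear equations alone. The
remaining equation `s i = 1` adds no relation, because the bilinear equations are homogeneous in
`s`. -/
theorem isSmoothPoint_tjurinaIdeal (hs : s i = 1) (hxs : Matrix.vecMul s (evalMatrix c x) = 0)
    (h : ∀ v, Matrix.vecMul v (evalMatrix (derivCoeff c) s) = 0 →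
      Matrix.mulVec (evalMatrix c x) v = 0 → v = 0) :
    IsSmoothPoint (tjurinaIdeal (linMatrix c) i) (Sum.elim x s) := by
  rw [tjurinaIdeal_eq_span]
  apply isSmoothPoint_of_linearIndependent
  · rintro (_ | b)
    · simp [tjurinaEqn, hs]
    · rw [eval_tjurinaEqn_some, hxs]
      rfl
  rw [Fintype.linearIndependent_iff]
  intro g hg
  simp only [Fintype.sum_option, grad_tjurinaEqn_none, grad_tjurinaEqn_some] at hg
  set v : Fin (t + 1) → ℂ := fun b => g (some b) with hv
  have h1 : Matrix.vecMul v (evalMatrix (derivCoeff c) s) = 0 := by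
    ext l
    have := congrFun hg (Sum.inl l)
    simpa [Matrix.vecMul, dotProduct, hv] using this
  have h2 : ∀ a, g none * (Pi.single i 1 : Fin t → ℂ) a +
      Matrix.mulVec (evalMatrix c x) v a = 0 := by
    intro a
    have := congrFun hg (Sum.inr a)
    simpa [Matrix.mulVec, dotProduct, hv, Pi.single_apply, mul_comm] using this
  have h3 : dotProduct s (Matrix.mulVec (evalMatrix c x) v) = 0 := by
    rw [Matrix.dotProduct_mulVec, hxs, zero_dotProduct]
  -- Pairing the `s`-part of the relation with `s` kills `M(x)v` and leaves the coefficient of `s i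
  -- - 1`, since `s i = 1`.
  have h4 : g none = 0 := by
    have : ∑ a, s a * (g none * (Pi.single i 1 : Fin t → ℂ) a +
      Matrix.mulVec (evalMatrix c x) v a) = 0 := by simp [h2]
    simp only [mul_add, Finset.sum_add_distrib] at this
    rw [show ∑ a, s a * Matrix.mulVec (evalMatrix c x) v a = 0 from h3] at this
    simpa [Pi.single_apply, hs] using this
  have h5 : v = 0 := h v h1 (by
    ext a
    simpa [h4] using h2 a)
  rintro (_ | b)
  · exact h4
  · exact congrFun h5 b

/-- Along the exceptional fibre, the rank of the matrix of derivatives is maximal at the smooth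
points of the Tjurina transform. -/
theorem rank_le_of_isSmoothPoint_tjurinaIdeal {s₀ s₁ : Fin t → ℂ} (h₀ : s₀ i = 1) (h₁ : s₁ i = 1)
    (h : IsSmoothPoint (tjurinaIdeal (linMatrix c) i) (Sum.elim 0 s₀)) :
    (evalMatrix (derivCoeff c) s₁).rank ≤ (evalMatrix (derivCoeff c) s₀).rank := by
  set A := evalMatrix (derivCoeff c) with hA
  have hz : ∀ s : Fin t → ℂ, Matrix.vecMul s (evalMatrix c 0) = 0 := fun s => by
    rw [vecMul_evalMatrix, Matrix.mulVec_zero]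
  have hM0 : evalMatrix c 0 = 0 := by ext; simp [evalMatrix]
  obtain ⟨k, -, hk⟩ := exists_rows_linearIndependent (A s₀) rfl
  -- the equations whose gradients span all gradients at the point
  let F : Set (MvPolynomial (Fin N ⊕ Fin t) ℂ) :=
    insert (tjurinaEqn (linMatrix c) i none)
      (Set.range fun j => tjurinaEqn (linMatrix c) i (some (k j)))
  have hmem : ∀ o, tjurinaEqn (linMatrix c) i o ∈ tjurinaIdeal (linMatrix c) i := fun o => by
    rw [tjurinaIdeal_eq_span]
    exact Ideal.subset_span ⟨o, rfl⟩
  have hF : F ⊆ tjurinaIdeal (linMatrix c) i := by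
    rintro _ (rfl | ⟨j, rfl⟩)
    · exact hmem _
    · exact hmem _
  have hgrad : ∀ f ∈ tjurinaIdeal (linMatrix c) i,
      grad (Sum.elim 0 s₀) f ∈ Submodule.span ℂ (grad (Sum.elim 0 s₀) '' F) := by
    intro f hf
    rw [tjurinaIdeal_eq_span] at hf
    refine Submodule.span_le.2 ?_ (grad_mem_span_of_mem_span ?_ hf)
    · rintro _ ⟨_, ⟨_ | b, rfl⟩, rfl⟩
      · exact Submodule.subset_span ⟨_, Or.inl rfl, rfl⟩
      let φ : (Fin N → ℂ) →ₗ[ℂ] (Fin N ⊕ Fin t → ℂ) :=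
        { toFun := fun v => Sum.elim v 0
          map_add' := fun v w => by ext (_ | _) <;> simp
          map_smul' := fun a v => by ext (_ | _) <;> simp }
      have hφ : ∀ b, grad (Sum.elim 0 s₀) (tjurinaEqn (linMatrix c) i (some b)) = φ (A s₀ b) := by
        intro b
        rw [grad_tjurinaEqn_some, hM0]
        rfl
      have hb : A s₀ b ∈ Submodule.span ℂ (Set.range ((A s₀).submatrix k id).row) := by
        rw [hk]
        exact Submodule.subset_span ⟨b, rfl⟩
      have := Submodule.mem_map_of_mem (f := φ) hb
      rw [Submodule.map_span, ← hφ] at this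
      refine Submodule.span_mono ?_ this
      rintro _ ⟨_, ⟨j, rfl⟩, rfl⟩
      exact ⟨_, Or.inr ⟨j, rfl⟩, hφ _⟩
    · rintro _ ⟨_ | b, rfl⟩
      · simp [tjurinaEqn, h₀]
      · rw [eval_tjurinaEqn_some, hz]
        rfl
  -- Locally each equation is a combination of those in `F`. Taking gradients at the other points
  -- `(0, s)` of the fibre shows that the chosen rows still span all rows of `A s` wherever `g` does
  -- not vanish.
  have hrow : ∀ b, ∃ g : MvPolynomial (Fin N ⊕ Fin t) ℂ, eval (Sum.elim 0 s₀) g ≠ 0 ∧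
      ∀ s : Fin t → ℂ, s i = 1 → eval (Sum.elim 0 s) g ≠ 0 →
        A s b ∈ Submodule.span ℂ (Set.range ((A s).submatrix k id).row) := by
    intro b
    obtain ⟨g, hg0, hg⟩ := h.exists_mul_mem_span
      ((mem_zeroLocus_tjurinaIdeal_iff c).2 ⟨h₀, hz _⟩) hF hgrad (hmem (some b))
    refine ⟨g, hg0, fun s hs hgs => ?_⟩
    have h1 := grad_mem_span_of_mem_span (y := Sum.elim 0 s) ?_ hg
    · rw [grad_mul, eval_tjurinaEqn_some, hz, Pi.zero_apply, zero_smul, add_zero] at h1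
      have h2 := (Submodule.smul_mem_iff _ hgs).1 h1
      have h3 := Submodule.mem_map_of_mem (f := LinearMap.funLeft ℂ ℂ Sum.inl) h2
      rw [Submodule.map_span, grad_tjurinaEqn_some] at h3
      refine Submodule.span_le.2 ?_ h3
      rintro _ ⟨_, ⟨_, rfl | ⟨j, rfl⟩, rfl⟩, rfl⟩
      · rw [grad_tjurinaEqn_none]
        have h0 : LinearMap.funLeft ℂ ℂ Sum.inl (Pi.single (Sum.inr i) 1 : Fin N ⊕ Fin t → ℂ) = 0 := by
          ext l
          simp [LinearMap.funLeft_apply]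
        rw [h0]
        exact Submodule.zero_mem _
      · rw [grad_tjurinaEqn_some]
        exact Submodule.subset_span ⟨j, rfl⟩
    · rintro _ (rfl | ⟨j, rfl⟩)
      · simp [tjurinaEqn, hs]
      · rw [eval_tjurinaEqn_some, hz]
        rfl
  choose g hg0 hg using hrow
  obtain ⟨r, hr⟩ : ∃ r, (A s₁).rank = r := ⟨_, rfl⟩
  obtain ⟨f₁, f₂, hdet⟩ := exists_submatrix_det_ne_zero (A s₁) hr
  rw [hr]
  -- restrict to the line through the two points
  let S : Fin t → Polynomial ℂ := fun a =>
    Polynomial.C (s₀ a) + Polynomial.X * Polynomial.C (s₁ a - s₀ a)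
  let line : ℂ → Fin t → ℂ := fun τ a => s₀ a + τ * (s₁ a - s₀ a)
  have hline0 : line 0 = s₀ := by ext; simp [line]
  have hline1 : line 1 = s₁ := by ext; simp [line]
  let G : Fin (t + 1) → Polynomial ℂ := fun b => aeval (Sum.elim 0 S) (g b)
  have hG : ∀ b τ, (G b).eval τ = eval (Sum.elim 0 (line τ)) (g b) := by
    intro b τ
    change Polynomial.evalRingHom τ (aeval _ (g b)) = _
    rw [aeval_def, Polynomial.algebraMap_eq, ← coe_eval₂Hom, ← RingHom.comp_apply]
    congr 1
    ext z
    · simp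
    · rcases z with l | a <;> simp [S, line]
  let D : Polynomial ℂ := (Matrix.of fun p q =>
    ∑ a, Polynomial.C (derivCoeff c (f₁ p, f₂ q, a)) * S a).det
  have hD : ∀ τ, D.eval τ = ((A (line τ)).submatrix f₁ f₂).det := by
    intro τ
    change Polynomial.evalRingHom τ (Matrix.det _) = _
    rw [RingHom.map_det]
    congr 1
    ext p q
    simp [hA, evalMatrix, S, line, Polynomial.eval_finsetSum]
  -- The factors `G b` are nonzero at parameter `0` and `D` is nonzero at parameter `1`, so some
  -- point of the line has both the spanning property and rank at least that of `A s₁`.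
  have hne : (∏ b, G b) * D ≠ 0 := by
    refine mul_ne_zero (Finset.prod_ne_zero_iff.2 fun b _ h0 => hg0 b ?_) fun h0 => hdet ?_
    · rw [← hline0, ← hG, h0, Polynomial.eval_zero]
    · have h1 := hD 1
      rw [h0, Polynomial.eval_zero, hline1] at h1
      exact h1.symm
  obtain ⟨τ, hτ⟩ : ∃ τ, ((∏ b, G b) * D).eval τ ≠ 0 := by
    by_contra! hall
    exact hne (Polynomial.funext fun τ => by rw [hall, Polynomial.eval_zero])
  rw [Polynomial.eval_mul, Polynomial.eval_prod, mul_ne_zero_iff, Finset.prod_ne_zero_iff, hD] at hτ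
  refine (le_rank_of_submatrix_det_ne_zero _ _ _ hτ.2).trans ?_
  rw [Matrix.rank_eq_finrank_span_row]
  have hsub : Submodule.span ℂ (Set.range (A (line τ)).row) ≤
      Submodule.span ℂ (Set.range ((A (line τ)).submatrix k id).row) := by
    rw [Submodule.span_le]
    rintro _ ⟨b, rfl⟩
    refine hg b _ ?_ ?_
    · simp [line, h₀, h₁]
    · rw [← hG]
      exact hτ.1 b (Finset.mem_univ b)
  refine (Submodule.finrank_mono hsub).trans ?_
  exact (finrank_range_le_card _).trans (by simp)

end TjurinaPoints

/-! ### Gradients of maximal minors -/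

section MinorGradients

variable {σ : Type*} {y : σ → ℂ}

lemma grad_mul_eq_zero {f g : MvPolynomial σ ℂ} (hf : eval y f = 0) (hg : eval y g = 0) :
    grad y (f * g) = 0 := by
  rw [grad_mul, hf, hg, zero_smul, zero_smul, add_zero]

lemma grad_C_mul (a : ℂ) (f : MvPolynomial σ ℂ) : grad y (C a * f) = a • grad y f := by
  rw [C_mul', map_smul]

/-- Each term of the Leibniz expansion either contains the zero entry or has two factors vanishing
at `y`, one from the row and one from the column. -/
lemma grad_det_eq_zero {n : Type*} [Fintype n] [DecidableEq n]
    (P : Matrix n n (MvPolynomial σ ℂ)) (a k : n) (h0 : P a k = 0)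
    (hrow : ∀ l, eval y (P a l) = 0) (hcol : ∀ b, eval y (P b k) = 0) : grad y P.det = 0 := by
  rw [Matrix.det_apply, map_sum]
  refine Finset.sum_eq_zero fun τ _ => ?_
  rw [Units.smul_def, map_zsmul]
  suffices grad y (∏ i, P (τ i) i) = 0 by rw [this, smul_zero]
  rw [← Finset.mul_prod_erase _ _ (Finset.mem_univ k)]
  rcases eq_or_ne (τ k) a with h | h
  · rw [h, h0, zero_mul, map_zero]
  · apply grad_mul_eq_zero (hcol _)
    rw [map_prod]
    have hne : τ.symm a ≠ k := fun h' => h (by rw [← h', Equiv.apply_symm_apply])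
    refine Finset.prod_eq_zero (Finset.mem_erase.2 ⟨hne, Finset.mem_univ _⟩) ?_
    rw [Equiv.apply_symm_apply]
    exact hrow _

/-- Replacing row `a` by the combination with weights `s` multiplies the determinant by the nonzero
constant `s a` and reduces to `grad_det_eq_zero`. -/
lemma grad_det_eq_zero_of_vecMul {n : Type*} [Fintype n] [DecidableEq n]
    (P : Matrix n n (MvPolynomial σ ℂ)) (k : n) {s : n → ℂ} (hs : s ≠ 0)
    (h0 : ∑ b, C (s b) * P b k = 0) (hrow : ∀ l, ∑ b, s b * eval y (P b l) = 0)
    (hcol : ∀ b, eval y (P b k) = 0) : grad y P.det = 0 := by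
  obtain ⟨a, ha⟩ := Function.ne_iff.1 hs
  have hdet := Matrix.det_updateRow_sum P a fun b => C (s b)
  have h1 : grad y (P.updateRow a (∑ b, (C (s b) : MvPolynomial σ ℂ) • P b)).det = 0 := by
    apply grad_det_eq_zero _ a k
    · simpa using h0
    · intro l
      simpa using hrow l
    · intro b
      rcases eq_or_ne b a with rfl | h
      · simp [hcol]
      · simp [Matrix.updateRow_ne h, hcol]
  rw [hdet, smul_eq_mul, grad_C_mul] at h1
  exact (smul_eq_zero.1 h1).resolve_left ha

/-- The maximal minor not using the `j`-th column. -/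
def omitMinor {t : ℕ} {R : Type*} [CommRing R] (P : Matrix (Fin t) (Fin (t + 1)) R)
    (j : Fin (t + 1)) : R :=
  (P.submatrix id j.succAbove).det

/-- Repeated rows or columns give zero. Otherwise, the chosen rows and columns are permutations of
those of the omitted minor. -/
lemma exists_det_eq_mul_omitMinor {t : ℕ} {R : Type*} [CommRing R]
    (P : Matrix (Fin t) (Fin (t + 1)) R) {j : Fin (t + 1)} (f : Fin t → Fin t)
    (g : Fin t → Fin (t + 1)) (hg : ∀ k, g k ≠ j) :
    ∃ n : ℤ, (P.submatrix f g).det = n * omitMinor P j := by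
  by_cases hf : Function.Injective f
  swap
  · simp only [Function.Injective, not_forall] at hf
    obtain ⟨a, b, hab, hne⟩ := hf
    refine ⟨0, ?_⟩
    rw [Matrix.det_zero_of_row_eq hne (by ext; simp [hab])]
    simp
  by_cases hgi : Function.Injective g
  swap
  · simp only [Function.Injective, not_forall] at hgi
    obtain ⟨a, b, hab, hne⟩ := hgi
    refine ⟨0, ?_⟩
    rw [Matrix.det_zero_of_column_eq hne (by intro; simp [hab])]
    simp
  choose g' hg' using fun k => Fin.exists_succAbove_eq (hg k)
  have hg'i : Function.Injective g' := fun a b hab => hgi (by rw [← hg', ← hg', hab])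
  let e := Equiv.ofBijective f (Finite.injective_iff_bijective.1 hf)
  let e' := Equiv.ofBijective g' (Finite.injective_iff_bijective.1 hg'i)
  refine ⟨Equiv.Perm.sign e * Equiv.Perm.sign e', ?_⟩
  have h1 : P.submatrix f g =
      ((P.submatrix id j.succAbove).submatrix id e').submatrix e id := by
    ext a b
    simp [e, e', hg']
  rw [h1, Matrix.det_permute, Matrix.det_permute', omitMinor]
  push_cast
  ring

/-- If a matrix of polynomials is killed at a point by a row vector `s` and a column vector `v`,
and `s P v = 0` identically, then the gradients of all maximal minors are proportional. -/
lemma grad_minor_mem_span {t : ℕ} (P : Matrix (Fin t) (Fin (t + 1)) (MvPolynomial σ ℂ))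
    {s : Fin t → ℂ} (hs : s ≠ 0) {v : Fin (t + 1) → ℂ} {j : Fin (t + 1)} (hv : v j ≠ 0)
    (hsP : ∀ b, ∑ a, s a * eval y (P a b) = 0) (hPv : ∀ a, ∑ b, eval y (P a b) * v b = 0)
    (hsPv : ∑ a, C (s a) * ∑ b, C (v b) * P a b = 0) (f : Fin t → Fin t)
    (g : Fin t → Fin (t + 1)) :
    grad y (P.submatrix f g).det ∈ Submodule.span ℂ {grad y (omitMinor P j)} := by
  have key : ∀ g : Fin t → Fin (t + 1), (∀ k, g k ≠ j) →
      grad y (P.submatrix f g).det ∈ Submodule.span ℂ {grad y (omitMinor P j)} := by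
    intro g hg
    obtain ⟨n, hn⟩ := exists_det_eq_mul_omitMinor P f g hg
    rw [hn, ← zsmul_eq_mul, map_zsmul]
    exact zsmul_mem (Submodule.mem_span_singleton_self _) n
  by_cases hf : Function.Injective f
  swap
  · simp only [Function.Injective, not_forall] at hf
    obtain ⟨a, b, hab, hne⟩ := hf
    rw [Matrix.det_zero_of_row_eq hne (by ext; simp [hab]), map_zero]
    exact zero_mem _
  by_cases hgi : Function.Injective g
  swap
  · simp only [Function.Injective, not_forall] at hgi
    obtain ⟨a, b, hab, hne⟩ := hgi
    rw [Matrix.det_zero_of_column_eq hne (by intro; simp [hab]), map_zero]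
    exact zero_mem _
  by_cases hg : ∀ k, g k ≠ j
  · exact key g hg
  push Not at hg
  obtain ⟨k, hk⟩ := hg
  let e := Equiv.ofBijective f (Finite.injective_iff_bijective.1 hf)
  -- replace the `j`-th column by the combination of all columns with coefficients `v`
  let δ : Fin (t + 1) → MvPolynomial σ ℂ := fun l => (P.submatrix f (Function.update g k l)).det
  have hδ : ∀ l, ((P.submatrix f g).updateCol k fun a => P (f a) l).det = δ l := by
    intro l
    congr 1
    ext a b
    rcases eq_or_ne b k with rfl | h
    · simp
    · simp [Matrix.updateCol_ne h, Function.update_of_ne h]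
  have hsum : ((P.submatrix f g).updateCol k fun a => ∑ l, C (v l) * P (f a) l).det =
      ∑ l, C (v l) * δ l := by
    let L : (Fin t → MvPolynomial σ ℂ) →ₗ[MvPolynomial σ ℂ] MvPolynomial σ ℂ :=
      { toFun := fun u => ((P.submatrix f g).updateCol k u).det
        map_add' := Matrix.det_updateCol_add _ k
        map_smul' := Matrix.det_updateCol_smul _ k }
    have hcomb : (fun a => ∑ l, C (v l) * P (f a) l) =
        ∑ l, (C (v l) : MvPolynomial σ ℂ) • fun a => P (f a) l := by
      ext1 a
      simp
    calc _ = L (∑ l, (C (v l) : MvPolynomial σ ℂ) • fun a => P (f a) l) := by rw [← hcomb]; rfl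
      _ = _ := by
        rw [map_sum]
        refine Finset.sum_congr rfl fun l _ => ?_
        rw [map_smul, smul_eq_mul, ← hδ]
        rfl
  have hzero : grad y ((P.submatrix f g).updateCol k fun a => ∑ l, C (v l) * P (f a) l).det = 0 := by
    refine grad_det_eq_zero_of_vecMul (s := s ∘ e) _ k (fun h => hs ?_) ?_ ?_ ?_
    · ext a
      simpa using congrFun h (e.symm a)
    · simp only [Matrix.updateCol_self, Function.comp_apply]
      exact (Equiv.sum_comp e fun a => C (s a) * ∑ b, C (v b) * P a b).trans hsPv
    · intro l
      rcases eq_or_ne l k with rfl | h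
      · have := congrArg (eval y) hsPv
        simp only [map_sum, map_mul, eval_C, map_zero] at this
        simp only [Matrix.updateCol_self, Function.comp_apply, map_sum, map_mul, eval_C]
        exact (Equiv.sum_comp e fun a => s a * ∑ b, v b * eval y (P a b)).trans this
      · simp only [Matrix.updateCol_ne h, Function.comp_apply, Matrix.submatrix_apply]
        exact (Equiv.sum_comp e fun a => s a * eval y (P a (g l))).trans (hsP _)
    · intro a
      simpa [mul_comm] using hPv (f a)
  have hj : δ j = (P.submatrix f g).det := by
    simp only [δ, ← hk, Function.update_eq_self]
  -- Expanding the vanishing gradient expresses `v j` times the gradient of the given minor through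
  -- minors that avoid column `j`, because `g` is injective.
  rw [hsum, map_sum, ← Finset.add_sum_erase _ _ (Finset.mem_univ j), grad_C_mul, hj,
    add_eq_zero_iff_eq_neg] at hzero
  rw [← Submodule.smul_mem_iff _ hv, hzero, Submodule.neg_mem_iff]
  refine Submodule.sum_mem _ fun l hl => ?_
  rw [grad_C_mul]
  refine Submodule.smul_mem _ _ (key _ fun k' => ?_)
  rcases eq_or_ne k' k with rfl | h
  · simpa using Finset.ne_of_mem_erase hl
  · rw [Function.update_of_ne h, ← hk]
    exact fun h' => h (hgi h')

end MinorGradients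

/-- Outside the origin, the Jacobian matrix of the Tjurina transform of an isolated
Cohen-Macaulay codimension 2 singularity has maximal rank. -/
theorem IsICMC2.eq_zero_of_vecMul_of_mulVec {t N : ℕ} {c : LinCoeff t (t + 1) N} (hc : IsICMC2 c)
    {x : Fin N → ℂ} (hx : x ≠ 0) {s : Fin t → ℂ} (hs : s ≠ 0)
    (hxs : Matrix.vecMul s (evalMatrix c x) = 0) {v : Fin (t + 1) → ℂ}
    (h₁ : Matrix.vecMul v (evalMatrix (derivCoeff c) s) = 0)
    (h₂ : Matrix.mulVec (evalMatrix c x) v = 0) : v = 0 := by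
  by_contra hv
  obtain ⟨j, hj⟩ := Function.ne_iff.1 hv
  obtain ⟨⟨-, -, -, hheight⟩, hsing⟩ := hc
  have heval : ∀ (f : Fin t → Fin t) (g : Fin t → Fin (t + 1)),
      eval x ((linMatrix c).submatrix f g).det = ((evalMatrix c x).submatrix f g).det := by
    intro f g
    rw [RingHom.map_det]
    congr 1
    ext a b
    exact eval_linMatrix c x _ _
  have hvan : ∀ d ∈ {d | ∃ (f : Fin t → Fin t) (g : Fin t → Fin (t + 1)),
      d = ((linMatrix c).submatrix f g).det}, eval x d = 0 := by
    rintro _ ⟨f, g, rfl⟩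
    rw [heval]
    exact (submatrix_det_eq_zero_iff_exists_vecMul _).2 ⟨s, hs, hxs⟩ f g
  have hzl : x ∈ zeroLocus ℂ (minorsIdeal (linMatrix c) t) := by
    rw [minorsIdeal, zeroLocus_span]
    exact hvan
  have hsm : IsSmoothPoint (minorsIdeal (linMatrix c) t) x := by
    by_contra h
    exact hx (hsing x ⟨hzl, h⟩)
  -- With all gradients proportional, smoothness of `X` at `x` forces height at most one, whereas
  -- the ideal has height two.
  have hle := hsm.height_le_one hzl (f₀ := omitMinor (linMatrix c) j)
    (Ideal.subset_span ⟨id, j.succAbove, rfl⟩) (by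
      intro f hf
      refine Submodule.span_le.2 ?_ (grad_mem_span_of_mem_span hvan hf)
      rintro _ ⟨_, ⟨f, g, rfl⟩, rfl⟩
      refine grad_minor_mem_span (linMatrix c) hs hj ?_ ?_ ?_ f g
      · intro b
        simp only [eval_linMatrix]
        exact congrFun hxs b
      · intro a
        simp only [eval_linMatrix]
        exact congrFun h₂ a
      · apply MvPolynomial.funext
        intro w
        simp only [map_sum, map_mul, eval_C, eval_linMatrix, map_zero]
        have : dotProduct s (Matrix.mulVec (evalMatrix c w) v) = 0 := by
          rw [Matrix.dotProduct_mulVec, vecMul_evalMatrix, dotProduct_comm,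
            Matrix.dotProduct_mulVec, h₁, zero_dotProduct]
        rw [← this]
        simp only [dotProduct, Matrix.mulVec, mul_comm])
  rw [hheight, Nat.sub_self, Nat.add_sub_cancel_left] at hle
  exact absurd hle (by decide)

/-! ### Calculus of generic properties -/

lemma Generic.mono {ι : Type*} {P Q : (ι → ℂ) → Prop} (h : Generic P) (hPQ : ∀ c, P c → Q c) :
    Generic Q := by
  obtain ⟨G, hG, hGP⟩ := h
  exact ⟨G, hG, fun c hc => hPQ c (hGP c hc)⟩

lemma Generic.and {ι : Type*} {P Q : (ι → ℂ) → Prop} (hP : Generic P) (hQ : Generic Q) :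
    Generic fun c => P c ∧ Q c := by
  obtain ⟨G, hG, hGP⟩ := hP
  obtain ⟨H, hH, hHQ⟩ := hQ
  refine ⟨G * H, mul_ne_zero hG hH, fun c hc => ?_⟩
  rw [map_mul] at hc
  exact ⟨hGP c (left_ne_zero_of_mul hc), hHQ c (right_ne_zero_of_mul hc)⟩

lemma Generic.forall_finite {ι κ : Type*} [Finite κ] {P : κ → (ι → ℂ) → Prop}
    (h : ∀ k, Generic (P k)) : Generic fun c => ∀ k, P k c := by
  have := Fintype.ofFinite κ
  choose G hG hGP using h
  refine ⟨∏ k, G k, Finset.prod_ne_zero_iff.2 fun k _ => hG k, fun c hc k => hGP k c ?_⟩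
  rw [map_prod] at hc
  exact Finset.prod_ne_zero_iff.1 hc k (Finset.mem_univ k)

/-- A generic property of some of the coordinates is generic. -/
lemma Generic.comp {ι κ : Type*} {P : (κ → ℂ) → Prop} (h : Generic P) {e : κ → ι}
    (he : Function.Injective e) : Generic fun c : ι → ℂ => P (c ∘ e) := by
  obtain ⟨G, hG, hGP⟩ := h
  refine ⟨rename e G, ?_, fun c hc => hGP _ ?_⟩
  · rwa [Ne, map_eq_zero_iff _ (rename_injective e he)]
  · rwa [eval_rename] at hc

/-! ### Elimination for homogeneous systems -/

section Elimination

attribute [local instance] MvPolynomial.gradedAlgebra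

lemma isHomogeneous_span_range {σ κ : Type*} {f : κ → MvPolynomial σ ℂ} {d : ℕ}
    (hf : ∀ j, (f j).IsHomogeneous d) :
    (Ideal.span (Set.range f)).IsHomogeneous (homogeneousSubmodule σ ℂ) := by
  apply Ideal.homogeneous_span
  rintro _ ⟨j, rfl⟩
  exact ⟨d, hf j⟩

/-- By the Nullstellensatz the radical contains all variables. -/
lemma exists_pow_le_of_zeroLocus_subset {σ : Type*} [Finite σ] {I : Ideal (MvPolynomial σ ℂ)}
    (h : ∀ s ∈ zeroLocus ℂ I, s = 0) :
    ∃ K, Ideal.span (Set.range (X : σ → MvPolynomial σ ℂ)) ^ K ≤ I := by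
  apply Ideal.exists_pow_le_of_le_radical_of_fg
  · rw [← vanishingIdeal_zeroLocus_eq_radical (K := ℂ), Ideal.span_le]
    rintro _ ⟨i, rfl⟩ s hs
    simp [h s hs]
  · exact IsNoetherian.noetherian _

lemma monomial_mem_span_X_pow {σ : Type*} {K : ℕ} {μ : σ →₀ ℕ} (hμ : μ.degree = K) (a : ℂ) :
    monomial μ a ∈ Ideal.span (Set.range (X : σ → MvPolynomial σ ℂ)) ^ K := by
  rw [Ideal.mem_span_pow_iff_exists_isHomogeneous]
  refine ⟨monomial μ (C a), isHomogeneous_monomial _ hμ, ?_⟩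
  rw [eval_monomial, monomial_eq]

/-- Elimination: if a family of systems of homogeneous equations has no nontrivial zero for one
value of the parameters, then it has no nontrivial zero for generic parameters. -/
theorem generic_of_forall_eq_zero {ι σ κ : Type*} [Finite σ] [Fintype κ] {d : ℕ}
    (f : κ → MvPolynomial σ (MvPolynomial ι ℂ)) (hf : ∀ j, (f j).IsHomogeneous d) (c₀ : ι → ℂ)
    (h : ∀ s : σ → ℂ, (∀ j, eval s (map (eval c₀) (f j)) = 0) → s = 0) :
    Generic fun c : ι → ℂ => ∀ s : σ → ℂ, (∀ j, eval s (map (eval c) (f j)) = 0) → s = 0 := by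
  classical
  have := Fintype.ofFinite σ
  obtain ⟨K, hK⟩ := exists_pow_le_of_zeroLocus_subset
    (I := Ideal.span (Set.range fun j => map (eval c₀) (f j))) (by
      intro s hs
      rw [zeroLocus_span] at hs
      exact h s fun j => hs _ ⟨j, rfl⟩)
  let Mon := {μ // μ ∈ Finset.finsuppAntidiag (Finset.univ : Finset σ) K}
  have hdeg : ∀ μ : σ →₀ ℕ, μ ∈ Finset.finsuppAntidiag (Finset.univ : Finset σ) K ↔ μ.degree = K := by
    intro μ
    simp [Finset.mem_finsuppAntidiag, Finsupp.degree_eq_sum]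
  have hmem : ∀ μ : Mon, ∃ a : κ → MvPolynomial σ ℂ,
      ∑ j, a j * map (eval c₀) (f j) = monomial μ.1 1 := fun μ =>
    Ideal.mem_span_range_iff_exists_fun.1 (hK (monomial_mem_span_X_pow ((hdeg _).1 μ.2) 1))
  choose a ha using hmem
  -- The certificates writing the degree `K` monomials in the ideal at `c₀` are kept fixed while the
  -- parameters vary. The coefficient matrix `T` below is the identity at `c₀`, so its determinant
  -- is a nonzero polynomial.
  let P : Mon → MvPolynomial σ (MvPolynomial ι ℂ) := fun μ => ∑ j, map C (a μ j) * f j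
  have hP : ∀ c μ, map (eval c) (P μ) = ∑ j, a μ j * map (eval c) (f j) := by
    intro c μ
    have hC : (eval c).comp C = RingHom.id ℂ := by ext; simp
    simp only [P, map_sum, map_mul, map_map]
    simp only [hC, map_id]
  let T : Matrix Mon Mon (MvPolynomial ι ℂ) := Matrix.of fun μ ν => coeff ν.1 (P μ)
  have hT : ∀ c, (T.map (eval c)) = Matrix.of fun μ ν : Mon => coeff ν.1 (map (eval c) (P μ)) := by
    intro c
    ext μ ν
    simp [T, coeff_map]
  refine ⟨T.det, fun h0 => ?_, fun c hc s hs => ?_⟩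
  · have h1 : eval c₀ T.det = 1 := by
      rw [RingHom.map_det]
      change (T.map (eval c₀)).det = 1
      rw [hT, ← Matrix.det_one (n := Mon)]
      congr 1
      ext μ ν
      rw [Matrix.of_apply, hP, ha, coeff_monomial]
      rcases eq_or_ne μ ν with rfl | hne
      · rw [if_pos rfl, Matrix.one_apply_eq]
      · rw [if_neg fun h => hne (Subtype.ext h), Matrix.one_apply_ne hne]
    rw [h0, map_zero] at h1
    exact zero_ne_one h1
  · have hw : Matrix.mulVec (T.map (eval c)) (fun ν => eval s (monomial ν.1 1)) = 0 := by
      ext μ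
      have hmemI : map (eval c) (P μ) ∈ Ideal.span (Set.range fun j => map (eval c) (f j)) := by
        rw [hP]
        exact Ideal.mem_span_range_iff_exists_fun.2 ⟨_, rfl⟩
      have h1 := homogeneousComponent_mem_of_mem
        (isHomogeneous_span_range fun j => (hf j).map (eval c)) hmemI K
      have h2 : Ideal.span (Set.range fun j => map (eval c) (f j)) ≤ RingHom.ker (eval s) := by
        rw [Ideal.span_le]
        rintro _ ⟨j, rfl⟩
        exact hs j
      have h3 : eval s (homogeneousComponent K (map (eval c) (P μ))) = 0 := h2 h1
      have h4 : homogeneousComponent K (map (eval c) (P μ)) =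
          ∑ ν : Mon, monomial ν.1 (coeff ν.1 (map (eval c) (P μ))) := by
        ext e
        simp only [coeff_homogeneousComponent, coeff_sum, coeff_monomial]
        split_ifs with he
        · rw [Finset.sum_eq_single ⟨e, (hdeg e).2 he⟩ (fun ν _ hν => if_neg fun h =>
            hν (Subtype.ext h)) (fun h => absurd (Finset.mem_univ _) h), if_pos rfl]
        · exact (Finset.sum_eq_zero fun ν _ => if_neg fun h : ν.1 = e => he (h ▸ (hdeg _).1 ν.2)).symm
      rw [hT, Pi.zero_apply, ← h3, h4, map_sum, Matrix.mulVec, dotProduct]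
      refine Finset.sum_congr rfl fun ν _ => ?_
      rw [Matrix.of_apply, eval_monomial, eval_monomial, one_mul]
    have hw' := Matrix.eq_zero_of_mulVec_eq_zero (by
      rw [RingHom.map_det] at hc
      exact hc) hw
    ext i
    have h1 : (Finsupp.single i K).prod (fun n e => s n ^ e) = 0 := by
      have := congrFun hw' ⟨Finsupp.single i K, by rw [hdeg]; simp⟩
      rwa [eval_monomial, one_mul] at this
    rw [Finsupp.prod_single_index (h := fun n e => s n ^ e) (pow_zero _)] at h1
    exact eq_zero_of_pow_eq_zero h1

end Elimination

/-! ### Matrices of linear forms with independent rows -/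

section FullRank

/-- The rows of the matrix of linear forms are independent at every nonzero point. -/
def FullRank {m n k : ℕ} (c : LinCoeff m n k) : Prop :=
  ∀ s, s ≠ 0 → ∀ v, Matrix.vecMul v (evalMatrix c s) = 0 → v = 0

lemma fullRank_iff {m n k : ℕ} {c : LinCoeff m n k} :
    FullRank c ↔ ∀ s, (∀ p : (Fin m → Fin m) × (Fin m → Fin n),
      ((evalMatrix c s).submatrix p.1 p.2).det = 0) → s = 0 := by
  refine forall_congr' fun s => ?_
  rw [Prod.forall, submatrix_det_eq_zero_iff_exists_vecMul]
  constructor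
  · rintro h ⟨v, hv, hv'⟩
    by_contra hs
    exact hv (h hs v hv')
  · intro h hs v hv'
    by_contra hv
    exact hs (h ⟨v, hv, hv'⟩)

lemma isHomogeneous_det {σ R n : Type*} [CommRing R] [Fintype n] [DecidableEq n]
    {P : Matrix n n (MvPolynomial σ R)} (h : ∀ i j, (P i j).IsHomogeneous 1) :
    P.det.IsHomogeneous (Fintype.card n) := by
  rw [Matrix.det_apply]
  refine IsHomogeneous.sum _ _ _ fun τ _ => ?_
  have := IsHomogeneous.prod Finset.univ (fun i => P (τ i) i) (fun _ => 1) fun i _ => h _ _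
  simp only [Finset.sum_const, Finset.card_univ, smul_eq_mul, mul_one] at this
  rw [Units.smul_def]
  exact (homogeneousSubmodule σ R _).toAddSubgroup.zsmul_mem this _

/-- Full rank says that the maximal minors have only the trivial common zero, so elimination applies
to them. -/
theorem FullRank.generic {m n k : ℕ} {c₀ : LinCoeff m n k} (h : FullRank c₀) :
    Generic fun c : LinCoeff m n k => FullRank c := by
  let U : Matrix (Fin m) (Fin n) (MvPolynomial (Fin k) (MvPolynomial (Fin m × Fin n × Fin k) ℂ)) :=
    Matrix.of fun i j => ∑ l, C (X (i, j, l)) * X l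
  have hU : ∀ c s (p : (Fin m → Fin m) × (Fin m → Fin n)),
      eval s (map (eval c) (U.submatrix p.1 p.2).det) =
        ((evalMatrix c s).submatrix p.1 p.2).det := by
    intro c s p
    rw [RingHom.map_det, RingHom.map_det]
    congr 1
    ext i j
    simp [U, evalMatrix]
  have := generic_of_forall_eq_zero (fun p : (Fin m → Fin m) × (Fin m → Fin n) =>
    (U.submatrix p.1 p.2).det) (fun p => isHomogeneous_det fun i j => by
      change (∑ l, C (X (p.1 i, p.2 j, l)) * X l).IsHomogeneous 1
      exact IsHomogeneous.sum _ _ _ fun l _ => isHomogeneous_C_mul_X _ _) c₀ (by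
        simp only [hU]
        exact fullRank_iff.1 h)
  refine this.mono fun c hc => ?_
  simp only [hU] at hc
  exact fullRank_iff.2 hc

lemma exists_fullRank {m n k : ℕ} (h : m + k ≤ n + 1) : ∃ c : LinCoeff m n k, FullRank c := by
  -- Toeplitz matrix: `v` times the matrix at `s` is the coefficient vector of the product of the
  -- polynomials with coefficients `v` and `s`. By `m + k ≤ n + 1` all its coefficients fit in the
  -- `n` columns.
  refine ⟨fun p => if (p.2.1 : ℕ) = p.1 + p.2.2 then 1 else 0, fun s hs v hv => ?_⟩
  let p : Polynomial ℂ := ∑ j, Polynomial.C (v j) * Polynomial.X ^ (j : ℕ)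
  let q : Polynomial ℂ := ∑ i, Polynomial.C (s i) * Polynomial.X ^ (i : ℕ)
  have hcoeff : ∀ {m : ℕ} (v : Fin m → ℂ) (j : Fin m),
      (∑ j, Polynomial.C (v j) * Polynomial.X ^ (j : ℕ)).coeff (j : ℕ) = v j := by
    intro m v j
    simp [Polynomial.coeff_X_pow, Fin.val_inj]
  have hpq : p * q = 0 := by
    ext l
    have : (p * q).coeff l = ∑ j : Fin m, ∑ i : Fin k, if l = (j : ℕ) + i then v j * s i else 0 := by
      simp only [p, q, Finset.sum_mul_sum, Polynomial.finsetSum_coeff]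
      refine Finset.sum_congr rfl fun j _ => Finset.sum_congr rfl fun i _ => ?_
      rw [show Polynomial.C (v j) * Polynomial.X ^ (j : ℕ) *
        (Polynomial.C (s i) * Polynomial.X ^ (i : ℕ)) =
        Polynomial.C (v j * s i) * Polynomial.X ^ ((j : ℕ) + i) by rw [map_mul, pow_add]; ring]
      rw [Polynomial.coeff_C_mul_X_pow]
    rw [this, Polynomial.coeff_zero]
    by_cases hl : l < n
    · have := congrFun hv ⟨l, hl⟩
      simpa [Matrix.vecMul, dotProduct, evalMatrix, Finset.mul_sum] using this
    · refine Finset.sum_eq_zero fun j _ => Finset.sum_eq_zero fun i _ => if_neg ?_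
      have := j.2
      have := i.2
      omega
  have hq : q ≠ 0 := by
    intro hq
    apply hs
    ext i
    rw [← hcoeff s i]
    change q.coeff i = 0
    rw [hq, Polynomial.coeff_zero]
  have hp := (mul_eq_zero.1 hpq).resolve_right hq
  ext j
  rw [← hcoeff v j]
  change p.coeff j = 0
  rw [hp, Polynomial.coeff_zero]

lemma eq_zero_of_eventually_eval_eq_zero {ι : Type*} [Fintype ι] {G : MvPolynomial ι ℂ}
    {c₁ : ι → ℂ} (h : ∀ᶠ c in nhds c₁, eval c G = 0) : G = 0 := by
  obtain ⟨ε, hε, hball⟩ := Metric.mem_nhds_iff.1 h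
  refine funext_set (fun i => Metric.ball (c₁ i) ε) (fun i => ?_) fun c hc => ?_
  · exact infinite_of_mem_nhds (c₁ i) (Metric.ball_mem_nhds _ hε)
  · rw [map_zero]
    apply hball
    rwa [ball_pi _ hε]

/-! ### Nontrivial zeros of bilinear systems -/

section Bilinear

variable {m a : ℕ}

/-- Affine coordinates on the first factor of a product of projective spaces. -/
def affLeft (y : Fin (a + m) → ℂ) : Fin (a + 1) → ℂ := Fin.cons 1 fun i => y (Fin.castAdd m i)

/-- Affine coordinates on the second factor of a product of projective spaces. -/
def affRight (y : Fin (a + m) → ℂ) : Fin (m + 1) → ℂ := Fin.cons 1 fun j => y (Fin.natAdd a j)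

/-- A system of bilinear forms which is the identity in affine coordinates. -/
def affCoeff : LinCoeff (m + 1) (a + m) (a + 1) := fun p =>
  Fin.addCases (fun i => if p.1 = 0 ∧ p.2.2 = i.succ then 1 else 0)
    (fun j => if p.1 = j.succ ∧ p.2.2 = 0 then 1 else 0) p.2.1

/-- The values of a system of bilinear forms in affine coordinates. -/
def bilinValue (z : LinCoeff (m + 1) (a + m) (a + 1) × (Fin (a + m) → ℂ)) : Fin (a + m) → ℂ :=
  Matrix.vecMul (affRight z.2) (evalMatrix z.1 (affLeft z.2))

lemma bilinValue_affCoeff (y : Fin (a + m) → ℂ) :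
    bilinValue ((affCoeff : LinCoeff (m + 1) (a + m) (a + 1)), y) = y := by
  ext l
  induction l using Fin.addCases with
  | left i =>
    simp [bilinValue, Matrix.vecMul, dotProduct, evalMatrix, affCoeff, affRight, affLeft,
      Fin.sum_univ_succ, Fin.succ_ne_zero, (Fin.succ_ne_zero _).symm]
  | right j =>
    simp [bilinValue, Matrix.vecMul, dotProduct, evalMatrix, affCoeff, affRight, affLeft,
      Fin.sum_univ_succ, Fin.succ_ne_zero, (Fin.succ_ne_zero _).symm]

lemma contDiff_bilinValue :
    ContDiff ℂ 1 (bilinValue (m := m) (a := a)) := by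
  have hl : ∀ i, ContDiff ℂ 1
      fun z : LinCoeff (m + 1) (a + m) (a + 1) × (Fin (a + m) → ℂ) => affLeft z.2 i := by
    intro i
    refine Fin.cases ?_ (fun i => ?_) i
    · simp only [affLeft, Fin.cons_zero]
      fun_prop
    · simp only [affLeft, Fin.cons_succ]
      fun_prop
  have hr : ∀ i, ContDiff ℂ 1
      fun z : LinCoeff (m + 1) (a + m) (a + 1) × (Fin (a + m) → ℂ) => affRight z.2 i := by
    intro i
    refine Fin.cases ?_ (fun i => ?_) i
    · simp only [affRight, Fin.cons_zero]
      fun_prop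
    · simp only [affRight, Fin.cons_succ]
      fun_prop
  rw [contDiff_pi]
  intro l
  simp only [bilinValue, Matrix.vecMul, dotProduct, evalMatrix, Matrix.of_apply]
  fun_prop

/-- At `affCoeff` the system is the identity in `y`, hence `(c, y) ↦ (c, bilinValue (c, y))` has
surjective derivative and is locally open. Its image contains `(c, 0)` for all `c` near `affCoeff`.
-/
lemma eventually_exists_bilinValue_eq_zero :
    ∀ᶠ c in nhds (affCoeff : LinCoeff (m + 1) (a + m) (a + 1)), ∃ y, bilinValue (c, y) = 0 := by
  let z₁ : LinCoeff (m + 1) (a + m) (a + 1) × (Fin (a + m) → ℂ) := (affCoeff, 0)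
  let Ψ : LinCoeff (m + 1) (a + m) (a + 1) × (Fin (a + m) → ℂ) →
      LinCoeff (m + 1) (a + m) (a + 1) × (Fin (a + m) → ℂ) := fun z => (z.1, bilinValue z)
  have hb : HasStrictFDerivAt (bilinValue (m := m) (a := a)) (fderiv ℂ bilinValue z₁) z₁ :=
    contDiff_bilinValue.contDiffAt.hasStrictFDerivAt one_ne_zero
  have hΨ : HasStrictFDerivAt Ψ ((ContinuousLinearMap.fst ℂ _ _).prod (fderiv ℂ bilinValue z₁)) z₁ :=
    hasStrictFDerivAt_fst.prodMk hb
  have hinr : ∀ w, fderiv ℂ (bilinValue (m := m) (a := a)) z₁ (0, w) = w := by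
    have h1 : HasFDerivAt (fun y : Fin (a + m) → ℂ => bilinValue (affCoeff, y))
        ((fderiv ℂ bilinValue z₁).comp (ContinuousLinearMap.inr ℂ _ _)) 0 :=
      hb.hasFDerivAt.comp 0 (hasFDerivAt_prodMk_right affCoeff 0)
    have h2 : (fun y : Fin (a + m) → ℂ => bilinValue ((affCoeff : LinCoeff (m + 1) _ _), y)) = id :=
      funext bilinValue_affCoeff
    rw [h2] at h1
    have h3 := h1.unique (hasFDerivAt_id _)
    intro w
    exact congrArg (fun L : (Fin (a + m) → ℂ) →L[ℂ] (Fin (a + m) → ℂ) => L w) h3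
  have hsurj : ((ContinuousLinearMap.fst ℂ _ _).prod (fderiv ℂ bilinValue z₁)).range = ⊤ := by
    rw [LinearMap.range_eq_top]
    rintro ⟨v, w⟩
    refine ⟨(v, w - fderiv ℂ bilinValue z₁ (v, 0)), ?_⟩
    have : ((v, w - fderiv ℂ bilinValue z₁ (v, 0)) : LinCoeff (m + 1) (a + m) (a + 1) × _) =
        (v, 0) + (0, w - fderiv ℂ bilinValue z₁ (v, 0)) := by simp
    ext1
    · rfl
    · change fderiv ℂ bilinValue z₁ _ = w
      rw [this, map_add, hinr]
      simp
  have hmap := hΨ.map_nhds_eq_of_surj hsurj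
  have hrange : Set.range Ψ ∈ nhds z₁ := by
    have h1 : Ψ z₁ = z₁ := by
      simp only [Ψ, z₁, bilinValue_affCoeff]
    rw [← h1, ← hmap]
    exact Filter.range_mem_map
  have hcont : Filter.Tendsto (fun c : LinCoeff (m + 1) (a + m) (a + 1) =>
      (c, (0 : Fin (a + m) → ℂ))) (nhds affCoeff) (nhds z₁) := by
    have : Continuous (fun c : LinCoeff (m + 1) (a + m) (a + 1) => (c, (0 : Fin (a + m) → ℂ))) := by
      fun_prop
    exact this.tendsto affCoeff
  filter_upwards [hcont hrange] with c hc
  obtain ⟨⟨c', y⟩, hy⟩ := hc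
  obtain ⟨rfl, h2⟩ := Prod.mk.inj hy
  exact ⟨y, h2⟩

/-- A system of `a + m` bilinear equations on `ℂ^(m+1) × ℂ^(a+1)` has a nontrivial zero. -/
lemma not_fullRank (c : LinCoeff (m + 1) (a + m) (a + 1)) : ¬ FullRank c := by
  intro h
  obtain ⟨G, hG, hGP⟩ := h.generic
  apply hG
  apply eq_zero_of_eventually_eval_eq_zero (c₁ := affCoeff)
  filter_upwards [eventually_exists_bilinValue_eq_zero] with c hc
  by_contra hne
  obtain ⟨y, hy⟩ := hc
  have h1 : affLeft y ≠ 0 := fun h => one_ne_zero (congrFun h 0)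
  have h2 := congrFun (hGP c hne _ h1 _ hy) 0
  exact one_ne_zero h2

/-- The product `ℙ^(m-1) × ℙ^(a-1)` has dimension at least the number `n` of equations. Zero
equations are added to reduce to equality. -/
theorem exists_vecMul_evalMatrix_eq_zero {m n a : ℕ} (hm : 0 < m) (ha : 0 < a)
    (hn : n + 2 ≤ m + a) (c : LinCoeff m n a) :
    ∃ s, s ≠ 0 ∧ ∃ v, v ≠ 0 ∧ Matrix.vecMul v (evalMatrix c s) = 0 := by
  obtain ⟨m, rfl⟩ : ∃ k, m = k + 1 := ⟨m - 1, by omega⟩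
  obtain ⟨a, rfl⟩ : ∃ k, a = k + 1 := ⟨a - 1, by omega⟩
  let c' : LinCoeff (m + 1) (a + m) (a + 1) := fun p =>
    if h : (p.2.1 : ℕ) < n then c (p.1, ⟨p.2.1, h⟩, p.2.2) else 0
  have h := not_fullRank c'
  simp only [FullRank, not_forall] at h
  obtain ⟨s, hs, v, hv, hv0⟩ := h
  refine ⟨s, hs, v, hv0, ?_⟩
  ext l
  have := congrFun hv ⟨l, by omega⟩
  simpa [Matrix.vecMul, dotProduct, evalMatrix, c'] using this

end Bilinear

end FullRank

/-! ### Heights and dimensions under integral extensions -/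

section Integral

variable {R S : Type*} [CommRing R] [CommRing S] [Algebra R S]

lemma height_under_le [IsNoetherianRing R] [IsNoetherianRing S] [Algebra.HasGoingDown R S]
    (Q : Ideal S) [Q.IsPrime] : (Q.comap (algebraMap R S)).height ≤ Q.height := by
  have : Q.LiesOver (Q.comap (algebraMap R S)) := ⟨rfl⟩
  rw [Ideal.height_eq_height_add_of_liesOver_of_hasGoingDown (Q.comap (algebraMap R S)) Q]
  exact le_self_add

variable [Algebra.IsIntegral R S]

lemma strictMono_comap_of_isIntegral : StrictMono (PrimeSpectrum.comap (algebraMap R S)) :=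
  fun _ _ h => Ideal.IsIntegral.comap_lt_comap h

lemma ringKrullDim_le_of_isIntegral : ringKrullDim S ≤ ringKrullDim R :=
  Order.krullDim_le_of_strictMono _ strictMono_comap_of_isIntegral

lemma ringKrullDim_eq_of_isIntegral_of_injective (h : Function.Injective (algebraMap R S)) :
    ringKrullDim S = ringKrullDim R := by
  refine le_antisymm ringKrullDim_le_of_isIntegral (iSup_le fun l => ?_)
  obtain ⟨Q, -, hQ, hQl⟩ := Ideal.exists_ideal_over_prime_of_isIntegral l.head.asIdeal (⊥ : Ideal S)
    (by
      rw [← RingHom.ker_eq_comap_bot, (RingHom.injective_iff_ker_eq_bot _).1 h]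
      exact bot_le)
  have : Q.LiesOver l.head.asIdeal := ⟨hQl.symm⟩
  obtain ⟨L, hL, -⟩ := Ideal.exists_ltSeries_of_hasGoingUp l Q
  rw [← hL]
  exact Order.LTSeries.length_le_krullDim L

lemma height_le_height_under (Q : Ideal S) [Q.IsPrime] :
    Q.height ≤ (Q.comap (algebraMap R S)).height := by
  have h := Order.height_le_height_apply_of_strictMono _
    (strictMono_comap_of_isIntegral (R := R) (S := S)) ⟨Q, ‹_›⟩
  rwa [← PrimeSpectrum.height_eq_orderHeight, ← PrimeSpectrum.height_eq_orderHeight] at h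

end Integral

/-! ### Ideals of coordinate subspaces -/

section CoordIdeal

variable {ι : Type*} [DecidableEq ι]

/-- The homomorphism setting some of the variables to zero. -/
def killVars (s : Finset ι) : MvPolynomial ι ℂ →ₐ[ℂ] MvPolynomial {i // i ∉ s} ℂ :=
  aeval fun i => if h : i ∈ s then 0 else X ⟨i, h⟩

/-- The ideal of a coordinate subspace. -/
def coordIdeal (s : Finset ι) : Ideal (MvPolynomial ι ℂ) := RingHom.ker (killVars s)

instance (s : Finset ι) : (coordIdeal s).IsPrime := RingHom.ker_isPrime _

lemma eval_killVars (s : Finset ι) (v : {i // i ∉ s} → ℂ) (f : MvPolynomial ι ℂ) :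
    eval v (killVars s f) = eval (fun i => if h : i ∈ s then 0 else v ⟨i, h⟩) f := by
  have : (aeval v).comp (killVars s) = aeval fun i => if h : i ∈ s then (0 : ℂ) else v ⟨i, h⟩ := by
    ext i
    simp only [killVars, AlgHom.comp_apply, aeval_X]
    split_ifs <;> simp
  exact DFunLike.congr_fun this f

lemma X_mem_coordIdeal {s : Finset ι} {i : ι} : X i ∈ coordIdeal s ↔ i ∈ s := by
  rw [coordIdeal, RingHom.mem_ker, killVars, aeval_X]
  split_ifs with h <;> simp [h, X_ne_zero]

lemma coordIdeal_eq_span (s : Finset ι) : coordIdeal s = Ideal.span (X '' (s : Set ι)) := by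
  apply le_antisymm
  · intro f hf
    have h : (Ideal.Quotient.mkₐ ℂ (Ideal.span (X '' (s : Set ι)))).comp
        ((rename Subtype.val).comp (killVars s)) =
        Ideal.Quotient.mkₐ ℂ (Ideal.span (X '' (s : Set ι))) := by
      ext i
      simp only [killVars, AlgHom.comp_apply, aeval_X]
      split_ifs with hi
      · rw [map_zero, map_zero, eq_comm]
        exact Ideal.Quotient.eq_zero_iff_mem.2 (Ideal.subset_span ⟨i, hi, rfl⟩)
      · rw [rename_X]
    have h1 := DFunLike.congr_fun h f
    rw [AlgHom.comp_apply, AlgHom.comp_apply, show killVars s f = 0 from hf, map_zero,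
      map_zero] at h1
    exact Ideal.Quotient.eq_zero_iff_mem.1 h1.symm
  · rw [Ideal.span_le]
    rintro _ ⟨i, hi, rfl⟩
    exact X_mem_coordIdeal.2 hi

lemma height_coordIdeal [Finite ι] (s : Finset ι) : (coordIdeal s).height = s.card := by
  apply le_antisymm
  · refine (Ideal.height_le_spanFinrank _ Ideal.IsPrime.ne_top').trans ?_
    rw [coordIdeal_eq_span]
    refine Nat.cast_le.2 ((Submodule.spanFinrank_span_le_ncard_of_finite
      (s.finite_toSet.image _)).trans ?_)
    exact (Set.ncard_image_le s.finite_toSet).trans (Set.ncard_coe_finset s).le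
  · induction s using Finset.induction_on with
    | empty => simp
    | insert i s hi ih =>
      have hlt : coordIdeal s < coordIdeal (insert i s) := by
        refine lt_of_le_of_ne ?_ fun h => hi ?_
        · rw [coordIdeal_eq_span, coordIdeal_eq_span]
          exact Ideal.span_mono (Set.image_mono (by simp))
        · rw [← X_mem_coordIdeal, h, X_mem_coordIdeal]
          exact Finset.mem_insert_self _ _
      rw [Finset.card_insert_of_notMem hi, Nat.cast_add, Nat.cast_one]
      exact (add_le_add_left ih 1).trans (Ideal.height_add_one_le_of_lt_of_isPrime hlt)

end CoordIdeal

/-! ### Homogeneous systems of parameters -/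

section Parameters

attribute [local instance] MvPolynomial.gradedAlgebra

lemma coe_decompose_eq_homogeneousComponent {σ : Type*} (f : MvPolynomial σ ℂ) (n : ℕ) :
    (DirectSum.decompose (homogeneousSubmodule σ ℂ) f n : MvPolynomial σ ℂ) =
      homogeneousComponent n f :=
  decomposition.decompose'_apply f n

lemma homogeneousComponent_mul_mem {σ : Type*} {f g : MvPolynomial σ ℂ} {e n : ℕ}
    (hg : g.IsHomogeneous e) : ∃ f', homogeneousComponent n (f * g) = f' * g ∧
      (f' = 0 ∨ ∃ k, k + e = n ∧ f'.IsHomogeneous k) := by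
  by_cases h : e ≤ n
  · refine ⟨homogeneousComponent (n - e) f, ?_,
      Or.inr ⟨n - e, by omega, homogeneousComponent_isHomogeneous _ _⟩⟩
    have := DirectSum.coe_decompose_mul_of_right_mem_of_le (homogeneousSubmodule σ ℂ) (a := f) hg h
    simpa only [coe_decompose_eq_homogeneousComponent] using this
  · refine ⟨0, ?_, Or.inl rfl⟩
    have := DirectSum.coe_decompose_mul_of_right_mem_of_not_le (homogeneousSubmodule σ ℂ)
      (a := f) hg h
    rw [zero_mul]
    simpa only [coe_decompose_eq_homogeneousComponent] using this

/-- Graded Nakayama: a monomial of degree above `K` is a combination of the `g i` with coefficients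
of lower degree. By induction the finitely many monomials of degree at most `K` generate the module.
-/
lemma isIntegral_aeval_of_pow_le {σ ι : Type*} [Finite σ] [Fintype ι] {g : ι → MvPolynomial σ ℂ}
    {e : ι → ℕ} (hg : ∀ i, (g i).IsHomogeneous (e i)) (he : ∀ i, 0 < e i) {K : ℕ}
    (hK : Ideal.span (Set.range (X : σ → MvPolynomial σ ℂ)) ^ K ≤ Ideal.span (Set.range g)) :
    (aeval g : MvPolynomial ι ℂ →ₐ[ℂ] MvPolynomial σ ℂ).toRingHom.IsIntegral := by
  let _ : Algebra (MvPolynomial ι ℂ) (MvPolynomial σ ℂ) :=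
    (aeval g : MvPolynomial ι ℂ →ₐ[ℂ] MvPolynomial σ ℂ).toRingHom.toAlgebra
  have hsmul : ∀ (p : MvPolynomial ι ℂ) (f : MvPolynomial σ ℂ), p • f = aeval g p * f :=
    fun p f => rfl
  let B : Set (MvPolynomial σ ℂ) := (fun μ => monomial μ 1) '' {μ : σ →₀ ℕ | μ.degree ≤ K}
  have hB : B.Finite := (Finsupp.finite_of_degree_le K).image _
  let M : Submodule (MvPolynomial ι ℂ) (MvPolynomial σ ℂ) := Submodule.span _ B
  have hmon : ∀ n, ∀ μ : σ →₀ ℕ, μ.degree = n → ∀ a, monomial μ a ∈ M := by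
    intro n
    induction n using Nat.strong_induction_on with
    | _ n ih =>
      intro μ hμ a
      by_cases hn : n ≤ K
      · have : monomial μ a = (C a : MvPolynomial ι ℂ) • monomial μ (1 : ℂ) := by
          rw [hsmul, aeval_C, algebraMap_eq, C_mul_monomial, mul_one]
        rw [this]
        exact M.smul_mem _ (Submodule.subset_span ⟨μ, by simp [hμ, hn], rfl⟩)
      · have hmem : monomial μ a ∈ Ideal.span (Set.range g) :=
          hK (Ideal.pow_le_pow_right (by omega : K ≤ n) (monomial_mem_span_X_pow hμ a))
        obtain ⟨h, hh⟩ := Ideal.mem_span_range_iff_exists_fun.1 hmem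
        have h1 : monomial μ a = ∑ i, homogeneousComponent n (h i * g i) := by
          rw [← map_sum, hh, homogeneousComponent_eq_self (isHomogeneous_monomial _ hμ)]
        rw [h1]
        refine M.sum_mem fun i _ => ?_
        obtain ⟨f', hf', h2⟩ := homogeneousComponent_mul_mem (f := h i) (n := n) (hg i)
        rw [hf']
        rcases h2 with rfl | ⟨k, hk, hf'k⟩
        · rw [zero_mul]
          exact M.zero_mem
        · have : f' * g i = (X i : MvPolynomial ι ℂ) • f' := by
            rw [hsmul, aeval_X, mul_comm]
          rw [this]
          refine M.smul_mem _ ?_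
          rw [f'.as_sum]
          refine M.sum_mem fun ν hν => ih k (by have := he i; omega) ν ?_ _
          have := hf'k (mem_support_iff.1 hν)
          rw [Finsupp.degree_eq_weight_one]
          exact this
  have htop : M = ⊤ := by
    rw [eq_top_iff]
    intro f _
    rw [f.as_sum]
    exact M.sum_mem fun ν _ => hmon _ ν rfl _
  have : Module.Finite (MvPolynomial ι ℂ) (MvPolynomial σ ℂ) :=
    ⟨⟨hB.toFinset, by rw [hB.coe_toFinset]; exact htop⟩⟩
  exact fun x => Algebra.IsIntegral.isIntegral x

/-- A nonzero kernel would make the dimension of the image smaller than the number of variables, yet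
the target, of that same dimension, is integral over the image. -/
lemma injective_of_isIntegral {σ ι : Type*} [Finite σ] [Finite ι]
    (hcard : Nat.card ι = Nat.card σ) {φ : MvPolynomial ι ℂ →ₐ[ℂ] MvPolynomial σ ℂ}
    (hφ : φ.toRingHom.IsIntegral) : Function.Injective φ := by
  rw [injective_iff_map_eq_zero]
  by_contra! h
  obtain ⟨r, hr, hr0⟩ := h
  let _ : Algebra φ.range (MvPolynomial σ ℂ) := φ.range.val.toRingHom.toAlgebra
  have hint : Algebra.IsIntegral φ.range (MvPolynomial σ ℂ) :=
    ⟨RingHom.IsIntegral.tower_top φ.rangeRestrict.toRingHom φ.range.val.toRingHom hφ⟩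
  have h1 := ringKrullDim_succ_le_of_surjective φ.rangeRestrict.toRingHom
    φ.rangeRestrict_surjective (mem_nonZeroDivisors_of_ne_zero hr0) (Subtype.ext hr)
  have h2 := ringKrullDim_le_of_isIntegral (R := φ.range) (S := MvPolynomial σ ℂ)
  rw [MvPolynomial.ringKrullDim_of_isNoetherianRing, ringKrullDim_eq_zero_of_field, zero_add]
    at h1 h2
  rw [hcard] at h1
  have h3 := (add_le_add_left h2 1).trans h1
  exact absurd h3 (by
    rw [not_le]
    exact_mod_cast Nat.lt_succ_self _)

/-- The height and the dimension of the zero locus of an ideal, from homogeneous parameters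
some of which belong to the ideal while the others take all values on the zero locus. -/
theorem height_eq_and_ringKrullDim_eq {σ ι : Type*} [Finite σ] [Fintype ι] [DecidableEq ι]
    (hcard : Nat.card ι = Nat.card σ) {g : ι → MvPolynomial σ ℂ}
    {e : ι → ℕ} (hg : ∀ i, (g i).IsHomogeneous (e i)) (he : ∀ i, 0 < e i)
    (hg0 : ∀ z : σ → ℂ, (∀ i, eval z (g i) = 0) → z = 0)
    {I : Ideal (MvPolynomial σ ℂ)} {s : Finset ι} (hs : ∀ i ∈ s, g i ∈ I)
    (hI : ∀ v : ι → ℂ, (∀ i ∈ s, v i = 0) → ∃ z ∈ zeroLocus ℂ I, ∀ i, eval z (g i) = v i) :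
    I.height = s.card ∧
      ringKrullDim (MvPolynomial σ ℂ ⧸ vanishingIdeal ℂ (zeroLocus ℂ I)) =
        ((Nat.card ι - s.card : ℕ) : WithBot ℕ∞) := by
  obtain ⟨K, hK⟩ := exists_pow_le_of_zeroLocus_subset (I := Ideal.span (Set.range g)) (by
    intro z hz
    rw [zeroLocus_span] at hz
    exact hg0 z fun i => hz _ ⟨i, rfl⟩)
  have hint := isIntegral_aeval_of_pow_le hg he hK
  have hinj := injective_of_isIntegral hcard hint
  -- By `hI` the parameters map the zero locus onto the whole coordinate subspace, so a polynomial
  -- in them vanishing on the zero locus vanishes on that subspace.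
  have hI0 : ∀ h : MvPolynomial ι ℂ, aeval g h ∈ vanishingIdeal ℂ (zeroLocus ℂ I) →
      killVars s h = 0 := by
    intro h hh
    apply MvPolynomial.funext
    intro v
    obtain ⟨z, hz, hzv⟩ := hI (fun i => if h : i ∈ s then 0 else v ⟨i, h⟩) fun i hi => by simp [hi]
    have h1 : eval z (aeval g h) = 0 := hh z hz
    have h2 : (aeval z : MvPolynomial σ ℂ →ₐ[ℂ] ℂ).comp (aeval g) =
        aeval fun i => if h : i ∈ s then (0 : ℂ) else v ⟨i, h⟩ := by
      ext i
      simp only [AlgHom.comp_apply, aeval_X]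
      exact hzv i
    rw [eval_killVars, map_zero]
    exact (DFunLike.congr_fun h2 h).symm.trans h1
  have hIJ : I ≤ vanishingIdeal ℂ (zeroLocus ℂ I) := le_vanishingIdeal_zeroLocus I
  constructor
  · let _ : Algebra (MvPolynomial ι ℂ) (MvPolynomial σ ℂ) :=
      (aeval g : MvPolynomial ι ℂ →ₐ[ℂ] MvPolynomial σ ℂ).toRingHom.toAlgebra
    have : Algebra.IsIntegral (MvPolynomial ι ℂ) (MvPolynomial σ ℂ) := ⟨hint⟩
    have : FaithfulSMul (MvPolynomial ι ℂ) (MvPolynomial σ ℂ) :=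
      (faithfulSMul_iff_algebraMap_injective _ _).2 hinj
    apply le_antisymm
    · obtain ⟨Q, hQI, hQ, hQs⟩ := Ideal.exists_ideal_over_prime_of_isIntegral (coordIdeal s) I
        fun h hh => hI0 h (hIJ hh)
      refine (Ideal.height_mono hQI).trans ((height_le_height_under (R := MvPolynomial ι ℂ) Q).trans ?_)
      rw [hQs, height_coordIdeal]
    · rw [Ideal.height_eq_inf_minimalPrimes]
      refine le_iInf₂ fun Q hQ => ?_
      have := hQ.1.1
      refine le_trans ?_ (height_under_le (R := MvPolynomial ι ℂ) Q)
      rw [← height_coordIdeal]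
      refine Ideal.height_mono ?_
      rw [coordIdeal_eq_span, Ideal.span_le]
      rintro _ ⟨i, hi, rfl⟩
      apply hQ.1.2
      change aeval g (X i) ∈ I
      rw [aeval_X]
      exact hs i hi
  · let S := MvPolynomial σ ℂ ⧸ vanishingIdeal ℂ (zeroLocus ℂ I)
    let mk : MvPolynomial σ ℂ →ₐ[ℂ] S := Ideal.Quotient.mkₐ ℂ _
    let ψ : MvPolynomial {i // i ∉ s} ℂ →ₐ[ℂ] S := aeval fun i => mk (g i)
    have hψ : ψ.comp (killVars s) = mk.comp (aeval g) := by
      ext i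
      simp only [killVars, AlgHom.comp_apply, aeval_X]
      split_ifs with hi
      · rw [map_zero, eq_comm]
        exact Ideal.Quotient.eq_zero_iff_mem.2 (hIJ (hs i hi))
      · simp [ψ]
    have hsurj : ∀ h : MvPolynomial {i // i ∉ s} ℂ, killVars s (rename Subtype.val h) = h := by
      intro h
      have : (killVars s).comp (rename Subtype.val) = AlgHom.id ℂ _ := by
        ext i
        simp [killVars, i.2]
      exact DFunLike.congr_fun this h
    have hψint : ψ.toRingHom.IsIntegral := by
      apply RingHom.IsIntegral.tower_top (killVars s).toRingHom
      have h1 : ψ.toRingHom.comp (killVars s).toRingHom =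
          mk.toRingHom.comp (aeval g : MvPolynomial ι ℂ →ₐ[ℂ] MvPolynomial σ ℂ).toRingHom :=
        congrArg AlgHom.toRingHom hψ
      rw [h1]
      exact hint.trans _ _ (RingHom.isIntegral_of_surjective _ Ideal.Quotient.mk_surjective)
    have hψinj : Function.Injective ψ := by
      rw [injective_iff_map_eq_zero]
      intro h hh
      rw [← hsurj h]
      apply hI0
      rw [← Ideal.Quotient.eq_zero_iff_mem]
      have := DFunLike.congr_fun hψ (rename Subtype.val h)
      rw [AlgHom.comp_apply, hsurj, hh] at this
      exact this.symm
    let _ : Algebra (MvPolynomial {i // i ∉ s} ℂ) S := ψ.toRingHom.toAlgebra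
    have : Algebra.IsIntegral (MvPolynomial {i // i ∉ s} ℂ) S := ⟨hψint⟩
    rw [ringKrullDim_eq_of_isIntegral_of_injective (R := MvPolynomial {i // i ∉ s} ℂ) (S := S)
      hψinj, MvPolynomial.ringKrullDim_of_isNoetherianRing, ringKrullDim_eq_zero_of_field, zero_add]
    congr 2
    rw [Nat.card_eq_fintype_card, Nat.card_eq_fintype_card, Fintype.card_subtype_compl]
    simp

end Parameters

/-! ### Zero loci of maximal minors and their cones -/

lemma eval_det_submatrix_linMatrix {m n k r : ℕ} (a : LinCoeff m n k) (z : Fin k → ℂ)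
    (f : Fin r → Fin m) (g : Fin r → Fin n) :
    eval z ((linMatrix a).submatrix f g).det = ((evalMatrix a z).submatrix f g).det := by
  rw [RingHom.map_det]
  congr 1
  ext i j
  exact eval_linMatrix a z (f i) (g j)

lemma mem_zeroLocus_minorsIdeal {m n k : ℕ} {a : LinCoeff m n k} {z : Fin k → ℂ} :
    z ∈ zeroLocus ℂ (minorsIdeal (linMatrix a) m) ↔
      ∃ v, v ≠ 0 ∧ Matrix.vecMul v (evalMatrix a z) = 0 := by
  rw [← submatrix_det_eq_zero_iff_exists_vecMul, minorsIdeal, zeroLocus_span]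
  constructor
  · intro h f g
    rw [← eval_det_submatrix_linMatrix]
    exact h _ ⟨f, g, rfl⟩
  · rintro h _ ⟨f, g, rfl⟩
    exact (eval_det_submatrix_linMatrix a z f g).trans (h f g)

lemma mem_projZeros_minorsIdeal {m n k : ℕ} {a : LinCoeff m n k} {p : ℙ ℂ (Fin k → ℂ)} :
    p ∈ projZeros (minorsIdeal (linMatrix a) m) ↔
      ∃ v, v ≠ 0 ∧ Matrix.vecMul v (evalMatrix a p.rep) = 0 :=
  mem_zeroLocus_minorsIdeal

lemma exists_vecMul_evalMatrix_smul_eq_zero {m n k : ℕ} {a : LinCoeff m n k} {z : Fin k → ℂ}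
    (h : ∃ v, v ≠ 0 ∧ Matrix.vecMul v (evalMatrix a z) = 0) (τ : ℂ) :
    ∃ v, v ≠ 0 ∧ Matrix.vecMul v (evalMatrix a (τ • z)) = 0 := by
  obtain ⟨v, hv, hv0⟩ := h
  exact ⟨v, hv, by rw [evalMatrix_smul, Matrix.vecMul_smul, hv0, smul_zero]⟩

/-- The cone over the projective zero set of the maximal minors is their affine zero set. -/
lemma cone_projZeros_minorsIdeal {m n k : ℕ} {a : LinCoeff m n k} {z₀ : Fin k → ℂ} (hz₀ : z₀ ≠ 0)
    (h : z₀ ∈ zeroLocus ℂ (minorsIdeal (linMatrix a) m)) :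
    {v : Fin k → ℂ | ∃ p ∈ projZeros (minorsIdeal (linMatrix a) m), v ∈ p.submodule} =
      zeroLocus ℂ (minorsIdeal (linMatrix a) m) := by
  have hmk : ∀ z (hz : z ≠ 0), z ∈ zeroLocus ℂ (minorsIdeal (linMatrix a) m) →
      Projectivization.mk ℂ z hz ∈ projZeros (minorsIdeal (linMatrix a) m) := by
    intro z hz hmem
    obtain ⟨τ, hτ⟩ := Projectivization.exists_smul_eq_mk_rep ℂ z hz
    rw [mem_projZeros_minorsIdeal, ← hτ]
    exact exists_vecMul_evalMatrix_smul_eq_zero (mem_zeroLocus_minorsIdeal.1 hmem) _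
  ext z
  constructor
  · rintro ⟨p, hp, hz⟩
    rw [Projectivization.submodule_eq, Submodule.mem_span_singleton] at hz
    obtain ⟨τ, rfl⟩ := hz
    exact mem_zeroLocus_minorsIdeal.2
      (exists_vecMul_evalMatrix_smul_eq_zero (mem_projZeros_minorsIdeal.1 hp) τ)
  · intro hz
    by_cases h0 : z = 0
    -- The origin is in the cone only because the projective zero set is nonempty.
    · exact ⟨_, hmk z₀ hz₀ h, h0 ▸ Submodule.zero_mem _⟩
    · refine ⟨_, hmk z h0 hz, ?_⟩
      rw [Projectivization.submodule_mk]
      exact Submodule.mem_span_singleton_self z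

/-! ### Linear sections of the degeneracy locus -/

section Sections

variable {m n k p : ℕ} {a : LinCoeff m n k}

/-- The coefficients of the restriction to the subspace of the first coordinates. -/
def firstCoeff (h : p ≤ k) (a : LinCoeff m n k) : LinCoeff m n p :=
  fun q => a (q.1, q.2.1, Fin.castLE h q.2.2)

lemma sum_eq_sum_castLE {A : Type*} [AddCommMonoid A] (h : p ≤ k) {f : Fin k → A}
    (hf : ∀ i : Fin k, p ≤ i → f i = 0) : ∑ i, f i = ∑ i : Fin p, f (Fin.castLE h i) := by
  refine (Finset.sum_of_injOn (Fin.castLE h) (Fin.castLE_injective h).injOn (by simp) ?_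
    fun _ _ => rfl).symm
  intro i _ hi
  apply hf
  by_contra! hlt
  exact hi ⟨⟨i, hlt⟩, by simp, rfl⟩

lemma FullRank.eq_zero_of_firstCoeff {h : p ≤ k} (ha : FullRank (firstCoeff h a)) {z : Fin k → ℂ}
    (hz : ∀ i : Fin k, p ≤ i → z i = 0)
    (hv : ∃ v, v ≠ 0 ∧ Matrix.vecMul v (evalMatrix a z) = 0) : z = 0 := by
  obtain ⟨v, hv0, hv⟩ := hv
  have h1 : evalMatrix a z = evalMatrix (firstCoeff h a) fun i => z (Fin.castLE h i) := by
    ext i j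
    exact sum_eq_sum_castLE h fun l hl => by rw [hz l hl, mul_zero]
  by_contra hz0
  refine hv0 (ha _ (fun h0 => hz0 ?_) v (h1 ▸ hv))
  ext i
  by_cases hi : p ≤ i
  · exact hz i hi
  · exact congrFun h0 ⟨i, not_le.1 hi⟩

/-- A bilinear zero exists over the space spanned by the first `p` coordinate vectors and `w`. Its
`w`-coordinate is nonzero by `ha`, so it can be scaled to one. -/
lemma exists_vecMul_evalMatrix_eq_zero_of_firstCoeff {h : p ≤ k} (ha : FullRank (firstCoeff h a))
    (hm : 0 < m) (hn : n + 1 ≤ m + p) (w : Fin k → ℂ) :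
    ∃ z : Fin k → ℂ, (∀ i : Fin k, p ≤ i → z i = w i) ∧
      ∃ v, v ≠ 0 ∧ Matrix.vecMul v (evalMatrix a z) = 0 := by
  let L : Matrix (Fin k) (Fin (p + 1)) ℂ := Matrix.of fun i l =>
    if (i : ℕ) < p then if (l : ℕ) = i then 1 else 0 else if l = Fin.last p then w i else 0
  have hL₁ : ∀ u (i : Fin k) (hi : (i : ℕ) < p), L.mulVec u i = u ⟨i, by omega⟩ := by
    intro u i hi
    rw [Matrix.mulVec, dotProduct, Finset.sum_eq_single ⟨i, by omega⟩]
    · simp [L, hi]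
    · intro l _ hl
      have : (l : ℕ) ≠ i := fun h => hl (Fin.ext h)
      simp [L, hi, this]
    · simp
  have hL₂ : ∀ u (i : Fin k), p ≤ i → L.mulVec u i = w i * u (Fin.last p) := by
    intro u i hi
    simp [Matrix.mulVec, dotProduct, L, not_lt.2 hi]
  let a' : LinCoeff m n (p + 1) := fun q => ∑ i, a (q.1, q.2.1, i) * L i q.2.2
  have ha' : ∀ u, evalMatrix a' u = evalMatrix a (L.mulVec u) := by
    intro u
    ext i j
    simp only [evalMatrix, Matrix.of_apply, a', Matrix.mulVec, dotProduct, Finset.sum_mul,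
      Finset.mul_sum, mul_assoc]
    exact Finset.sum_comm
  obtain ⟨u, hu, hv⟩ := exists_vecMul_evalMatrix_eq_zero hm (Nat.succ_pos p) (by omega) a'
  rw [ha'] at hv
  have hlast : u (Fin.last p) ≠ 0 := by
    intro h0
    have h1 := ha.eq_zero_of_firstCoeff (fun i hi => by rw [hL₂ u i hi, h0, mul_zero]) hv
    apply hu
    ext l
    refine Fin.lastCases h0 (fun l => ?_) l
    have := congrFun h1 (Fin.castLE h l)
    rwa [hL₁ u _ l.2] at this
  refine ⟨(u (Fin.last p))⁻¹ • L.mulVec u, fun i hi => ?_,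
    exists_vecMul_evalMatrix_smul_eq_zero hv _⟩
  rw [Pi.smul_apply, hL₂ u i hi, smul_eq_mul, mul_comm (w i), inv_mul_cancel_left₀ hlast]

end Sections

/-! ### Codimension and dimension of the degeneracy locus -/

section Parameters

attribute [local instance] MvPolynomial.gradedAlgebra

lemma isHomogeneous_linMatrix {m n k : ℕ} (a : LinCoeff m n k) (i : Fin m) (j : Fin n) :
    (linMatrix a i j).IsHomogeneous 1 := by
  rw [linMatrix, Matrix.of_apply]
  exact IsHomogeneous.sum _ _ _ fun _ _ => isHomogeneous_C_mul_X _ _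

lemma isHomogeneous_minorsIdeal {m n k : ℕ} (a : LinCoeff m n k) (r : ℕ) :
    (minorsIdeal (linMatrix a) r).IsHomogeneous (homogeneousSubmodule (Fin k) ℂ) := by
  apply Ideal.homogeneous_span
  rintro _ ⟨f, g, rfl⟩
  exact ⟨_, isHomogeneous_det fun i j => isHomogeneous_linMatrix a (f i) (g j)⟩

/-- A homogeneous ideal whose zero locus meets a coordinate subspace only in the origin contains
homogeneous parameters for this subspace. -/
lemma exists_parameters {σ : Type*} [Finite σ] {I : Ideal (MvPolynomial σ ℂ)}
    (hI : I.IsHomogeneous (homogeneousSubmodule σ ℂ)) {s : Set σ}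
    (h : ∀ z ∈ zeroLocus ℂ I, (∀ i ∉ s, z i = 0) → z = 0) :
    ∃ K, 0 < K ∧ ∃ f : σ → MvPolynomial σ ℂ, (∀ i, f i ∈ I ∧ (f i).IsHomogeneous K) ∧
      ∀ z : σ → ℂ, (∀ i ∈ s, eval z (f i) = 0) → (∀ i ∉ s, z i = 0) → z = 0 := by
  have hX : (Ideal.span (X '' sᶜ) : Ideal (MvPolynomial σ ℂ)).IsHomogeneous
      (homogeneousSubmodule σ ℂ) := by
    apply Ideal.homogeneous_span
    rintro _ ⟨i, -, rfl⟩
    exact ⟨1, isHomogeneous_X ℂ i⟩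
  obtain ⟨K, hK⟩ := exists_pow_le_of_zeroLocus_subset (I := I ⊔ Ideal.span (X '' sᶜ)) (by
    intro z hz
    refine h z (fun f hf => hz f (Ideal.mem_sup_left hf)) fun i hi => ?_
    have := hz (X i) (Ideal.mem_sup_right (Ideal.subset_span ⟨i, hi, rfl⟩))
    rwa [aeval_X] at this)
  have hmem : ∀ i : σ, (X i : MvPolynomial σ ℂ) ^ (K + 1) ∈ I ⊔ Ideal.span (X '' sᶜ) := fun i =>
    hK (Ideal.pow_le_pow_right K.le_succ
      (Ideal.pow_mem_pow (Ideal.subset_span (Set.mem_range_self i)) _))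
  simp only [Submodule.mem_sup] at hmem
  choose f hf q hq hfq using hmem
  -- Both ideals are homogeneous, so passing to the degree `K + 1` part of `X i ^ (K + 1) = f i + q
  -- i` keeps the two summands in them.
  refine ⟨K + 1, K.succ_pos, fun i => homogeneousComponent (K + 1) (f i), fun i =>
    ⟨homogeneousComponent_mem_of_mem hI (hf i) _, homogeneousComponent_isHomogeneous _ _⟩,
    fun z hz hzs => ?_⟩
  ext i
  by_cases hi : i ∉ s
  · exact hzs i hi
  have hXi : ((X i : MvPolynomial σ ℂ) ^ (K + 1)).IsHomogeneous (K + 1) := by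
    simpa using (isHomogeneous_X ℂ i).pow (K + 1)
  have h1 := congrArg (homogeneousComponent (K + 1)) (hfq i)
  rw [map_add, homogeneousComponent_eq_self hXi] at h1
  have h2 : Ideal.span (X '' sᶜ) ≤ RingHom.ker (eval z) := by
    rw [Ideal.span_le]
    rintro _ ⟨j, hj, rfl⟩
    exact (eval_X _).trans (hzs j hj)
  have h3 : eval z (homogeneousComponent (K + 1) (q i)) = 0 :=
    h2 (homogeneousComponent_mem_of_mem hX (hq i) _)
  have h4 := congrArg (eval z) h1
  rw [map_add, hz i (not_not.1 hi), h3, map_pow, eval_X, add_zero] at h4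
  exact eq_zero_of_pow_eq_zero h4.symm

theorem height_minorsIdeal {t N p : ℕ} {h : p ≤ t} {a : LinCoeff (t + 1) N t}
    (ha : FullRank (firstCoeff h a)) (hN : N = t + p) :
    (minorsIdeal (linMatrix a) (t + 1)).height = p ∧
      ringKrullDim (MvPolynomial (Fin t) ℂ ⧸
        vanishingIdeal ℂ (zeroLocus ℂ (minorsIdeal (linMatrix a) (t + 1)))) =
          ((t - p : ℕ) : WithBot ℕ∞) := by
  let s : Finset (Fin t) := Finset.univ.filter fun i => (i : ℕ) < p
  have hs : ∀ i, i ∈ s ↔ (i : ℕ) < p := fun i => by simp [s]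
  have hcard : s.card = p := by
    simp [s, Fin.card_filter_val_lt, h]
  obtain ⟨K, hK, f, hf, hf0⟩ := exists_parameters (isHomogeneous_minorsIdeal a (t + 1)) (s := ↑s)
    fun z hz hzs => ha.eq_zero_of_firstCoeff (fun i hi => hzs i (by simpa [hs] using hi))
      (mem_zeroLocus_minorsIdeal.1 hz)
  -- The parameters are `p` forms from the ideal in the first places and the remaining coordinates
  -- themselves.
  have key := height_eq_and_ringKrullDim_eq rfl (g := fun i => if i ∈ s then f i else X i)
    (e := fun i => if i ∈ s then K else 1) (I := minorsIdeal (linMatrix a) (t + 1)) (s := s)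
    (fun i => by
      split_ifs
      · exact (hf i).2
      · exact isHomogeneous_X ℂ i)
    (fun i => by split_ifs <;> omega) ?_ (fun i hi => by simpa only [if_pos hi] using (hf i).1) ?_
  · rwa [hcard, Nat.card_eq_fintype_card, Fintype.card_fin] at key
  · intro z hz
    refine hf0 z (fun i hi => ?_) fun i hi => ?_
    · have := hz i
      rwa [if_pos (Finset.mem_coe.1 hi)] at this
    · have := hz i
      rwa [if_neg (mt Finset.mem_coe.2 hi), eval_X] at this
  · intro v hv
    obtain ⟨z, hz, hz0⟩ :=
      exists_vecMul_evalMatrix_eq_zero_of_firstCoeff ha t.succ_pos (by omega) v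
    have hzI := mem_zeroLocus_minorsIdeal.2 hz0
    refine ⟨z, hzI, fun i => ?_⟩
    split_ifs with hi
    · rw [hv i hi]
      exact hzI _ (hf i).1
    · rw [eval_X]
      exact hz i (by simpa [hs] using hi)

end Parameters

theorem generic_determinantal {t N : ℕ} (h₁ : t + 1 ≤ N) (h₂ : N < 2 * t) :
    Generic fun a : LinCoeff (t + 1) N t => IsDeterminantal (linMatrix a) (t + 1) ∧
      HasProjDim (projZeros (minorsIdeal (linMatrix a) (t + 1))) (2 * t - N - 1) := by
  obtain ⟨p, rfl⟩ : ∃ p, N = t + p := ⟨N - t, by omega⟩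
  have hp : p ≤ t := by omega
  obtain ⟨b, hb⟩ := exists_fullRank (m := t + 1) (n := t + p) (k := p) (by omega)
  refine (hb.generic.comp (e := fun q : Fin (t + 1) × Fin (t + p) × Fin p =>
    (q.1, q.2.1, Fin.castLE hp q.2.2)) ?_).mono fun a ha => ?_
  · rintro ⟨i, j, l⟩ ⟨i', j', l'⟩ h
    simpa using h
  · have ha' : FullRank (firstCoeff hp a) := ha
    obtain ⟨hht, hdim⟩ := height_minorsIdeal ha' rfl
    refine ⟨⟨by omega, le_rfl, h₁, ?_⟩, ?_⟩
    · rw [hht, show (t + 1 - (t + 1) + 1) * (t + p - (t + 1) + 1) = p by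
        rw [Nat.sub_self, zero_add, one_mul]; omega]
    -- Prescribing the value `1` on the last coordinates gives a nonzero point, because `N < 2 * t`
    -- means `p < t`. Hence `Σ` is nonempty.
    · obtain ⟨z, hz, hz0⟩ := exists_vecMul_evalMatrix_eq_zero_of_firstCoeff ha' t.succ_pos
        (by omega) 1
      have hz1 : z ≠ 0 := by
        intro h0
        have := hz ⟨t - 1, by omega⟩ (by simp; omega)
        rw [h0] at this
        exact zero_ne_one this
      rw [HasProjDim, cone_projZeros_minorsIdeal hz1 (mem_zeroLocus_minorsIdeal.2 hz0), hdim,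
        show 2 * t - (t + p) - 1 + 1 = t - p by omega]

/-! ### Generic rank and rank drops of `A(s)` -/

lemma Generic.derivCoeff {t N : ℕ} {Q : LinCoeff (t + 1) N t → Prop} (h : Generic Q) :
    Generic fun c : LinCoeff t (t + 1) N => Q (derivCoeff c) := by
  refine h.comp (e := fun p : Fin (t + 1) × Fin N × Fin t => (p.2.2, p.1, p.2.1)) ?_
  rintro ⟨a, b, d⟩ ⟨a', b', d'⟩ h
  simp only [Prod.mk.injEq] at h ⊢
  tauto

/-- The coordinate vectors are the points of comparison for ranks, since the `i`-th one lies in the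
chart `s i = 1`. -/
lemma generic_min_le_rank {m n k : ℕ} (i : Fin k) :
    Generic fun a : LinCoeff m n k => min m n ≤ (evalMatrix a (Pi.single i 1)).rank := by
  let f : Fin (min m n) → Fin m := Fin.castLE (min_le_left _ _)
  let g : Fin (min m n) → Fin n := Fin.castLE (min_le_right _ _)
  let U : Matrix (Fin (min m n)) (Fin (min m n)) (MvPolynomial (Fin m × Fin n × Fin k) ℂ) :=
    Matrix.of fun a b => X (f a, g b, i)
  have hU : ∀ c, eval c U.det = (Matrix.of fun a b => c (f a, g b, i)).det := by
    intro c
    rw [RingHom.map_det]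
    congr 1
    ext a b
    simp [U]
  refine ⟨U.det, fun h0 => ?_, fun c hc => ?_⟩
  · have h1 := hU fun p => if (p.1 : ℕ) = p.2.1 then 1 else 0
    have h2 : (Matrix.of fun a b : Fin (min m n) => if (f a : ℕ) = g b then (1 : ℂ) else 0) = 1 := by
      ext a b
      simp [f, g, Matrix.one_apply, Fin.val_inj]
    change _ = (Matrix.of fun a b : Fin (min m n) =>
      if (f a : ℕ) = g b then (1 : ℂ) else 0).det at h1
    rw [h0, h2, map_zero, Matrix.det_one] at h1
    exact zero_ne_one h1
  · rw [hU] at hc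
    refine le_rank_of_submatrix_det_ne_zero _ (f := f) (g := g) ?_
    have h1 : (evalMatrix c (Pi.single i 1)).submatrix f g = Matrix.of fun a b => c (f a, g b, i) := by
      ext a b
      simp [evalMatrix, Pi.single_apply]
    rwa [h1]

lemma rank_evalMatrix_smul {m n k : ℕ} (a : LinCoeff m n k) {τ : ℂ} (hτ : τ ≠ 0)
    (s : Fin k → ℂ) : (evalMatrix a (τ • s)).rank = (evalMatrix a s).rank := by
  rw [evalMatrix_smul]
  exact Matrix.rank_smul_of_mem_nonZeroDivisors _ (mem_nonZeroDivisors_of_ne_zero hτ)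

lemma rank_lt_of_vecMul_eq_zero {m n : ℕ} {A : Matrix (Fin m) (Fin n) ℂ} {v : Fin m → ℂ}
    (hv : v ≠ 0) (h : Matrix.vecMul v A = 0) : A.rank < m := by
  refine lt_of_le_of_ne A.rank_le_height fun hr => hv ?_
  exact (rank_eq_card_iff_vecMul A).1 (by rw [hr, Fintype.card_fin]) v h

/-- The bilinear system comes from the matrix if `t + 1 ≤ N` and from its transpose otherwise. The
dimension condition reads `N < 2 * t` in the first case and `3 ≤ N` in the second. -/
lemma exists_rank_lt {t N : ℕ} (h₁ : 3 ≤ N) (h₂ : N < 2 * t) (a : LinCoeff (t + 1) N t) :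
    ∃ s, s ≠ 0 ∧ (evalMatrix a s).rank < min (t + 1) N := by
  rcases le_or_gt (t + 1) N with h | h
  · obtain ⟨s, hs, v, hv, hvs⟩ :=
      exists_vecMul_evalMatrix_eq_zero (Nat.succ_pos t) (by omega) (by omega) a
    exact ⟨s, hs, (rank_lt_of_vecMul_eq_zero hv hvs).trans_le (le_min le_rfl h)⟩
  · let a' : LinCoeff N (t + 1) t := fun p => a (p.2.1, p.1, p.2.2)
    have ha' : ∀ s, evalMatrix a' s = (evalMatrix a s).transpose := fun s => rfl
    obtain ⟨s, hs, v, hv, hvs⟩ :=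
      exists_vecMul_evalMatrix_eq_zero (by omega) (by omega) (by omega) a'
    refine ⟨s, hs, ?_⟩
    have := rank_lt_of_vecMul_eq_zero hv hvs
    rw [ha', Matrix.rank_transpose] at this
    exact this.trans_le (le_min (by omega) le_rfl)

/-! ### The singular locus of the Tjurina transform -/

section Tjurina

variable {t N : ℕ} {c : LinCoeff t (t + 1) N}

/-- Rank is maximal at smooth points of the exceptional fibre. The hypothesis covers every `i`
because the chart is found only from a nonzero coordinate of `p`. -/
lemma zero_mem_tjurinaSing {p : ℙ ℂ (Fin t → ℂ)}
    (h : ∀ i, (evalMatrix (derivCoeff c) p.rep).rank <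
      (evalMatrix (derivCoeff c) (Pi.single i 1)).rank) :
    ((0, p) : (Fin N → ℂ) × ℙ ℂ (Fin t → ℂ)) ∈ tjurinaSing (linMatrix c) := by
  obtain ⟨i, hi⟩ := Function.ne_iff.1 p.rep_nonzero
  have h₀ : ((p.rep i)⁻¹ • p.rep) i = 1 := by simpa using inv_mul_cancel₀ hi
  refine ⟨i, hi, ?_, fun hsm => ?_⟩
  · refine (mem_zeroLocus_tjurinaIdeal_iff c).2 ⟨h₀, ?_⟩
    have : evalMatrix c 0 = 0 := by
      ext a b
      simp [evalMatrix]
    rw [this, Matrix.vecMul_zero]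
  · have := rank_le_of_isSmoothPoint_tjurinaIdeal c h₀ (s₁ := Pi.single i 1) (by simp) hsm
    rw [rank_evalMatrix_smul _ (inv_ne_zero hi)] at this
    exact (h i).not_ge this

lemma IsICMC2.of_mem_tjurinaSing (hc : IsICMC2 c) {y : (Fin N → ℂ) × ℙ ℂ (Fin t → ℂ)}
    (hy : y ∈ tjurinaSing (linMatrix c)) :
    y.1 = 0 ∧ ∃ v, v ≠ 0 ∧ Matrix.vecMul v (evalMatrix (derivCoeff c) y.2.rep) = 0 := by
  obtain ⟨i, hi, hmem, hsing⟩ := hy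
  obtain ⟨hs, hxs⟩ := (mem_zeroLocus_tjurinaIdeal_iff c).1 hmem
  have hs0 : (y.2.rep i)⁻¹ • y.2.rep ≠ 0 := fun h => by
    rw [h] at hs
    exact zero_ne_one hs
  have hx : y.1 = 0 := by
    by_contra hx
    exact hsing (isSmoothPoint_tjurinaIdeal c hs hxs fun v h₁ h₂ =>
      hc.eq_zero_of_vecMul_of_mulVec hx hs0 hxs h₁ h₂)
  refine ⟨hx, ?_⟩
  by_contra! hv
  refine hsing (isSmoothPoint_tjurinaIdeal c hs hxs fun v h₁ _ => ?_)
  by_contra hv0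
  refine hv v hv0 ?_
  rw [evalMatrix_smul, Matrix.vecMul_smul] at h₁
  exact (smul_eq_zero.1 h₁).resolve_left (inv_ne_zero hi)

lemma not_tjurinaSmooth (h₁ : 3 ≤ N) (h₂ : N < 2 * t)
    (hr : ∀ i, min (t + 1) N ≤ (evalMatrix (derivCoeff c) (Pi.single i 1)).rank) :
    ¬ TjurinaSmooth (linMatrix c) := by
  intro h
  obtain ⟨s, hs, hlt⟩ := exists_rank_lt h₁ h₂ (derivCoeff c)
  obtain ⟨τ, hτ⟩ := Projectivization.exists_smul_eq_mk_rep ℂ s hs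
  have : (0, Projectivization.mk ℂ s hs) ∈ tjurinaSing (linMatrix c) := by
    refine zero_mem_tjurinaSing fun i => ?_
    rw [← hτ, Units.smul_def, rank_evalMatrix_smul _ τ.ne_zero]
    exact hlt.trans_le (hr i)
  rw [h] at this
  exact this

lemma IsICMC2.tjurinaSmooth (hc : IsICMC2 c) (h : FullRank (derivCoeff c)) :
    TjurinaSmooth (linMatrix c) := by
  refine Set.eq_empty_of_forall_notMem fun y hy => ?_
  obtain ⟨-, v, hv, hv'⟩ := hc.of_mem_tjurinaSing hy
  exact hv (h _ y.2.rep_nonzero v hv')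

/-- The ideal has height two, and the height of a proper ideal is at most the dimension `N` of the
polynomial ring. -/
lemma IsICMC2.two_le (hc : IsICMC2 c) : 2 ≤ N := by
  have h := hc.1.2.2.2
  have h2 : (minorsIdeal (linMatrix c) t).height = 2 := by
    rw [h]
    norm_num
  have hne : minorsIdeal (linMatrix c) t ≠ ⊤ := by
    intro ht
    rw [ht, Ideal.height_top] at h2
    exact absurd h2 (by simp)
  have := Ideal.height_le_ringKrullDim_of_ne_top hne
  rw [h2, MvPolynomial.ringKrullDim_of_isNoetherianRing, ringKrullDim_eq_zero_of_field] at this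
  simpa using this

lemma IsICMC2.tjurinaSing_eq (hc : IsICMC2 c) (hN : t + 1 ≤ N)
    (hr : ∀ i, min (t + 1) N ≤ (evalMatrix (derivCoeff c) (Pi.single i 1)).rank) :
    tjurinaSing (linMatrix c) =
      {0} ×ˢ projZeros (minorsIdeal (linMatrix (derivCoeff c)) (t + 1)) := by
  ext ⟨x, p⟩
  rw [Set.mem_prod, mem_projZeros_minorsIdeal, Set.mem_singleton_iff]
  refine ⟨hc.of_mem_tjurinaSing, ?_⟩
  rintro ⟨hx, v, hv, hv'⟩
  dsimp only at hx hv'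
  subst hx
  refine zero_mem_tjurinaSing fun i => (rank_lt_of_vecMul_eq_zero hv hv').trans_le ?_
  exact (le_min le_rfl hN).trans (hr i)

end Tjurina

lemma generic_fullRank_derivCoeff {t N : ℕ} (h : 2 * t ≤ N) :
    Generic fun c : LinCoeff t (t + 1) N => FullRank (derivCoeff c) := by
  obtain ⟨a, ha⟩ := exists_fullRank (m := t + 1) (n := N) (k := t) (by omega)
  exact ha.generic.derivCoeff

end TjurinaTransform

end

open TjurinaTransform in
theorem mainTheorem4 (t N : ℕ) (ht : 1 ≤ t) :
    (Generic fun c : LinCoeff t (t + 1) N =>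
      IsICMC2 c →
        ((3 ≤ N ∨ t = 1) → (TjurinaSmooth (linMatrix c) ↔ 2 * t ≤ N)) ∧
        (t + 1 ≤ N → N < 2 * t →
          tjurinaSing (linMatrix c) =
            {0} ×ˢ projZeros (minorsIdeal (linMatrix (derivCoeff c)) (t + 1)) ∧
          IsDeterminantal (linMatrix (derivCoeff c)) (t + 1) ∧
          HasProjDim (projZeros (minorsIdeal (linMatrix (derivCoeff c)) (t + 1)))
            (2 * t - N - 1))) ∧
    (∀ Q : LinCoeff (t + 1) N t → Prop, Generic Q →
      Generic fun c : LinCoeff t (t + 1) N => Q (derivCoeff c)) := by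
  refine ⟨?_, fun Q hQ => hQ.derivCoeff⟩
  have hr : Generic fun c : LinCoeff t (t + 1) N => ∀ i,
      min (t + 1) N ≤ (evalMatrix (derivCoeff c) (Pi.single i 1)).rank :=
    Generic.forall_finite fun i => (generic_min_le_rank i).derivCoeff
  rcases le_or_gt (2 * t) N with hN | hN
  · refine (generic_fullRank_derivCoeff hN).mono fun c hfull hc => ⟨fun _ => ?_, fun _ h => ?_⟩
    · exact iff_of_true (hc.tjurinaSmooth hfull) hN
    · exact absurd h hN.not_gt
  have hsing : ∀ c : LinCoeff t (t + 1) N, IsICMC2 c →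
      (∀ i, min (t + 1) N ≤ (evalMatrix (derivCoeff c) (Pi.single i 1)).rank) →
      (3 ≤ N ∨ t = 1) → (TjurinaSmooth (linMatrix c) ↔ 2 * t ≤ N) := by
    rintro c hc hrc (h3 | rfl)
    · exact iff_of_false (not_tjurinaSmooth h3 hN hrc) hN.not_ge
    -- For `t = 1` the assumption `N < 2 * t` contradicts codimension two, so this case is empty.
    · exact absurd hc.two_le hN.not_ge
  rcases le_or_gt (t + 1) N with htN | htN
  · exact (hr.and (generic_determinantal htN hN).derivCoeff).mono fun c h hc =>
      ⟨hsing c hc h.1, fun _ _ => ⟨hc.tjurinaSing_eq htN h.1, h.2⟩⟩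
  · exact hr.mono fun c h hc => ⟨hsing c hc h, fun h' => absurd h' htN.not_ge⟩
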